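/- Let $d\ge 1$ be an integer and let $(\mathcal C,\mathcal E)$ be a skeletally small, idempotent complete $d$-exact category (in the sense of Jasso). A sequence $A_{d+1}\to A_d\to\cdots\to A_1\xrightarrow{\partial^A_1}A_0$ in $\mathcal C$ is called *left $d$-exact* if the induced sequence $$0\to\mathcal C(-,A_{d+1})\to\mathcal C(-,A_d)\to\cdots\to\mathcal C(-,A_1)\to\mathcal C(-,A_0)$$ of functors $\mathcal C^{\mathrm{op}}\to\mathrm{Ab}$ is exact. Assume that $\mathcal C$ has $d$-kernels, i.e. that every morphism $A_1\to A_0$ of $\mathcal C$ is the last morphism of a left $d$-exact sequence. Let $\mathcal X\subseteq\mathcal C$ be a full subcategory that is closed under isomorphisms, finite direct sums and direct summands, is contravariantly finite (each $C\in\mathcal C$ admits a morphism $X\to C$ with $X\in\mathcal X$ through which every morphism from an object of $\mathcal X$ to $C$ factors), and is generating (each $C\in\mathcal C$ admits an $\mathcal E$-admissible deflation $X\to C$ with $X\in\mathcal X$; here an $\mathcal E$-admissible deflation is the last morphism $B_1\to B_0$ of a member of $\mathcal E$). Let $\mathcal E_{\mathcal X}\subseteq\mathcal E$ consist of those $B_{d+1}\to\cdots\to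 B_1\to B_0$ in $\mathcal E$ for which $\mathcal C(-,B_1)|_{\mathcal X}\to\mathcal C(-,B_0)|_{\mathcal X}$ is an epimorphism. Let $K_0(\mathcal C,\mathcal E_{\mathcal X})$ be the quotient of the split Grothendieck group of $\mathcal C$ by the relations $\sum_{i=0}^{d+1}(-1)^i[B_i]=0$ for $B_\bullet\in\mathcal E_{\mathcal X}$, and write $[C]_{\mathcal X}$ for the class of $C\in\mathcal C$ in it. Let $\operatorname{mod}\mathcal X$ be the category of finitely presented additive functors $\mathcal X^{\mathrm{op}}\to\mathrm{Ab}$ and let $K_0(\operatorname{mod}\mathcal X)$ be its Grothendieck group with respect to short exact sequences. Then for every morphism $f$ of $\mathcal C$ the functor $\operatorname{Coker}(\mathcal C(-,f)|_{\mathcal X})$ is finitely presented, and there is a group homomorphism $\theta_{\mathcal X}\colon K_0(\operatorname{mod}\mathcal X)\to K_0(\mathcal C,\mathcal E_{\mathcal X})$ such that $$\theta_{\mathcal X}\bigl(\bigl[\operatorname{Coker}\bigl(\mathcal C(-,\partial^A_1)|_{\mathcal X}\bigr)\bigr]\bigr)=\sum_{i=0}^{d+1}(-1)^i[A_i]_{\mathcal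 X}\qquad(*)$$ holds for every sequence $A_\bullet$ in $\mathcal E$ and, more generally, for every left $d$-exact sequence $A_\bullet$ in $\mathcal C$. Moreover, $\theta_{\mathcal X}$ is the only group homomorphism $K_0(\operatorname{mod}\mathcal X)\to K_0(\mathcal C,\mathcal E_{\mathcal X})$ that satisfies $(*)$ for every left $d$-exact sequence $A_\bullet$ in $\mathcal C$. -/

import Mathlib

open CategoryTheory CategoryTheory.Limits

universe v u

namespace DExact

/-! ### Modules over a preadditive category -/

section Modules

variable (D : Type u) [Category.{v} D] [Preadditive D]

/-- A `D`-module `M : Dᵒᵖ ⥤ Ab` is finitely presented if it is additive and there is an exact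
sequence `D(-, A) ⟶ D(-, B) ⟶ M ⟶ 0`. (Exactness in the category of all functors
`Dᵒᵖ ⥤ Ab` and in its full subcategory of additive functors are both pointwise.) -/
def IsFinitelyPresented : ObjectProperty (Dᵒᵖ ⥤ AddCommGrpCat.{v}) := fun M =>
  M.Additive ∧
    ∃ (A B : D) (f : A ⟶ B) (p : preadditiveYoneda.obj B ⟶ M)
      (w : preadditiveYoneda.map f ≫ p = 0),
      (ShortComplex.mk (preadditiveYoneda.map f) p w).Exact ∧ Epi p

/-- The category `mod D` of finitely presented `D`-modules. -/
abbrev FPMod := (IsFinitelyPresented D).FullSubcategory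

end Modules

/-! ### Grothendieck groups -/

section SplitK0

variable (C : Type u) [Category.{v} C] [Preadditive C]

/-- The free abelian group on the isomorphism classes of objects of `C`. -/
abbrev FreeIso := FreeAbelianGroup (Quotient (isIsomorphicSetoid C))

/-- The generator given by the isomorphism class of `A`. -/
def isoClass {C : Type u} [Category.{v} C] (A : C) : FreeIso C :=
  FreeAbelianGroup.of (Quotient.mk (isIsomorphicSetoid C) A)

/-- The split Grothendieck group: `[A] - [B] + [C] = 0` for each split short exact sequence
`A ⟶ B ⟶ C`. -/
abbrev SplitK0 :=
  FreeIso C ⧸ AddSubgroup.closure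
    {r : FreeIso C | ∃ S : ShortComplex C, Nonempty S.Splitting ∧
      r = isoClass S.X₁ - isoClass S.X₂ + isoClass S.X₃}

/-- The class of `A` in the split Grothendieck group. -/
def splitClass {C : Type u} [Category.{v} C] [Preadditive C] (A : C) : SplitK0 C :=
  QuotientAddGroup.mk (isoClass A)

/-- The Grothendieck group `K₀(mod D)`: the split Grothendieck group of `mod D` modulo the
relations given by the short exact sequences of functors with terms in `mod D`. -/
abbrev K0Mod (D : Type u) [Category.{v} D] [Preadditive D] :=
  SplitK0 (FPMod D) ⧸ AddSubgroup.closure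
    {r : SplitK0 (FPMod D) | ∃ S : ShortComplex (FPMod D),
      (S.map (IsFinitelyPresented D).ι).ShortExact ∧
        r = splitClass S.X₁ - splitClass S.X₂ + splitClass S.X₃}

/-- The class in `K₀(mod D)` of a finitely presented module. -/
def modClass {D : Type u} [Category.{v} D] [Preadditive D] (M : Dᵒᵖ ⥤ AddCommGrpCat.{v})
    (hM : IsFinitelyPresented D M) : K0Mod D :=
  QuotientAddGroup.mk (splitClass (⟨M, hM⟩ : FPMod D))

/-- The Grothendieck group `K₀(C, E)` of a class `E` of sequences `B_{d+1} ⟶ ⋯ ⟶ B_0`. -/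
abbrev K0 (d : ℕ) (E : Set (ChainComplex C ℕ)) :=
  SplitK0 C ⧸ AddSubgroup.closure
    {r : SplitK0 C | ∃ B ∈ E,
      r = ∑ i ∈ Finset.range (d + 2), (-1 : ℤ) ^ i • splitClass (B.X i)}

/-- The class of `A` in `K₀(C, E)`. -/
def K0.cls {C : Type u} [Category.{v} C] [Preadditive C] (d : ℕ) (E : Set (ChainComplex C ℕ))
    (A : C) : K0 C d E :=
  QuotientAddGroup.mk (splitClass A)

end SplitK0

/-! ### `d`-exact sequences

A sequence `B_{d+1} ⟶ B_d ⟶ ⋯ ⟶ B_1 ⟶ B_0` is a chain complex indexed by `ℕ` whose terms in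
degrees `> d + 1` are zero objects. -/

section Sequences

variable {C : Type u} [Category.{v} C] [Preadditive C]

/-- `B_{d+1} ⟶ ⋯ ⟶ B_1 ⟶ B_0` is left `d`-exact: for each object `Z`, the sequence
`0 ⟶ C(Z, B_{d+1}) ⟶ ⋯ ⟶ C(Z, B_1) ⟶ C(Z, B_0)` of abelian groups is exact, at
`C(Z, B_{i+1})` for `0 ≤ i ≤ d`. (For `i = d` the incoming group is `C(Z, B_{d+2}) = 0`.) -/
structure IsLeftDExact (d : ℕ) (B : ChainComplex C ℕ) : Prop where
  isZero : ∀ i, d + 1 < i → IsZero (B.X i)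
  exact : ∀ (Z : C) (i : ℕ), i ≤ d →
    Function.Exact (fun g : Z ⟶ B.X (i + 2) => g ≫ B.d (i + 2) (i + 1))
      (fun g : Z ⟶ B.X (i + 1) => g ≫ B.d (i + 1) i)

/-- `B_{d+1} ⟶ B_d ⟶ ⋯ ⟶ B_0` is right `d`-exact: for each object `Z`, the sequence
`0 ⟶ C(B_0, Z) ⟶ C(B_1, Z) ⟶ ⋯ ⟶ C(B_{d+1}, Z)` of abelian groups is exact, at `C(B_0, Z)` and
at `C(B_{i+1}, Z)` for `0 ≤ i < d`. -/
structure IsRightDExact (d : ℕ) (B : ChainComplex C ℕ) : Prop where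
  isZero : ∀ i, d + 1 < i → IsZero (B.X i)
  epi : ∀ (Z : C) (g : B.X 0 ⟶ Z), B.d 1 0 ≫ g = 0 → g = 0
  exact : ∀ (Z : C) (i : ℕ), i < d →
    Function.Exact (fun g : B.X i ⟶ Z => B.d (i + 1) i ≫ g)
      (fun g : B.X (i + 1) ⟶ Z => B.d (i + 2) (i + 1) ≫ g)

/-- A `d`-exact sequence is one that is both left and right `d`-exact. -/
def IsDExact (d : ℕ) (B : ChainComplex C ℕ) : Prop :=
  IsLeftDExact d B ∧ IsRightDExact d B

variable (C) in
/-- `C` has `d`-kernels: each morphism is, up to isomorphism of arrows, the last morphism of a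
left `d`-exact sequence. -/
def HasDKernels (d : ℕ) : Prop :=
  ∀ ⦃X Y : C⦄ (f : X ⟶ Y), ∃ B : ChainComplex C ℕ,
    IsLeftDExact d B ∧ Nonempty (Arrow.mk (B.d 1 0) ≅ Arrow.mk f)

/-- A morphism of `d`-exact sequences is a weak isomorphism if two cyclically consecutive
components (indices modulo `d + 2`) are isomorphisms. -/
def IsWeakIso (d : ℕ) {B B' : ChainComplex C ℕ} (f : B ⟶ B') : Prop :=
  ∃ k ≤ d + 1, IsIso (f.f k) ∧ IsIso (f.f ((k + 1) % (d + 2)))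

/-- The diagram with rows `A_d ⟶ ⋯ ⟶ A_0` and `B_d ⟶ ⋯ ⟶ B_0` and vertical morphisms
`f_d, …, f_0` is a `d`-pullback diagram: its mapping cone
`A_d ⟶ A_{d-1} ⊕ B_d ⟶ ⋯ ⟶ A_0 ⊕ B_1 ⟶ B_0` is left `d`-exact.
A morphism `Z ⟶ A_k ⊕ B_{k+1}` is written as a pair `(x, y)`, with the signs of the first
components normalised. -/
structure IsDPullback (d : ℕ) {A B : ChainComplex C ℕ} (f : A ⟶ B) : Prop where
  /-- exactness at `C(Z, A_d)` -/
  mono : ∀ ⦃Z : C⦄ (z : Z ⟶ A.X d), z ≫ A.d d (d - 1) = 0 → z ≫ f.f d = 0 → z = 0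
  /-- exactness at `C(Z, A_k ⊕ B_{k+1})`; the condition `x ≫ A.d k (k - 1) = 0` is empty for
  `k = 0`, and for `k + 1 = d` the incoming term is `A_d` alone -/
  exact : ∀ ⦃Z : C⦄ (k : ℕ), k < d → ∀ (x : Z ⟶ A.X k) (y : Z ⟶ B.X (k + 1)),
    x ≫ A.d k (k - 1) = 0 → x ≫ f.f k = y ≫ B.d (k + 1) k →
      ∃ (x' : Z ⟶ A.X (k + 1)) (y' : Z ⟶ B.X (k + 2)), (k + 1 = d → y' = 0) ∧
        x' ≫ A.d (k + 1) k = x ∧ x' ≫ f.f (k + 1) + y' ≫ B.d (k + 2) (k + 1) = y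

/-- The diagram with rows `A_{d+1} ⟶ ⋯ ⟶ A_1` and `B_{d+1} ⟶ ⋯ ⟶ B_1` and vertical morphisms
`f_{d+1}, …, f_1` is a `d`-pushout diagram: its mapping cone
`A_{d+1} ⟶ A_d ⊕ B_{d+1} ⟶ ⋯ ⟶ A_1 ⊕ B_2 ⟶ B_1` is right `d`-exact.
A morphism `A_{k+1} ⊕ B_{k+2} ⟶ Z` is written as a pair `(x, y)`, with the signs of the first
components normalised. -/
structure IsDPushout (d : ℕ) {A B : ChainComplex C ℕ} (f : A ⟶ B) : Prop where
  /-- exactness at `C(B_1, Z)` -/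
  epi : ∀ ⦃Z : C⦄ (z : B.X 1 ⟶ Z), B.d 2 1 ≫ z = 0 → f.f 1 ≫ z = 0 → z = 0
  /-- exactness at `C(A_{k+1} ⊕ B_{k+2}, Z)`; for `k + 1 = d` there is no term `B_{d+2}`, and for
  `k = 0` the outgoing term is `B_1` alone -/
  exact : ∀ ⦃Z : C⦄ (k : ℕ), k < d → ∀ (x : A.X (k + 1) ⟶ Z) (y : B.X (k + 2) ⟶ Z),
    (k + 1 < d → B.d (k + 3) (k + 2) ≫ y = 0) → f.f (k + 2) ≫ y = A.d (k + 2) (k + 1) ≫ x →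
      ∃ (x' : A.X k ⟶ Z) (y' : B.X (k + 1) ⟶ Z), (k = 0 → x' = 0) ∧
        B.d (k + 2) (k + 1) ≫ y' = y ∧ f.f (k + 1) ≫ y' + A.d (k + 1) k ≫ x' = x

/-- `f` is (up to isomorphism of arrows) the first morphism `B_{d+1} ⟶ B_d` of a member of `E`. -/
def IsInflation (d : ℕ) (E : Set (ChainComplex C ℕ)) {X Y : C} (f : X ⟶ Y) : Prop :=
  ∃ B ∈ E, Nonempty (Arrow.mk (B.d (d + 1) d) ≅ Arrow.mk f)

/-- `f` is (up to isomorphism of arrows) the last morphism `B_1 ⟶ B_0` of a member of `E`. -/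
def IsDeflation (E : Set (ChainComplex C ℕ)) {X Y : C} (f : X ⟶ Y) : Prop :=
  ∃ B ∈ E, Nonempty (Arrow.mk (B.d 1 0) ≅ Arrow.mk f)

/-- `(C, E)` is a `d`-exact category. Objects and end terms that are prescribed are prescribed up
to isomorphism; this makes no difference, as `E` is closed under isomorphisms by `weakIso`. -/
structure IsDExactStructure (d : ℕ) (E : Set (ChainComplex C ℕ)) : Prop where
  isDExact : ∀ B ∈ E, IsDExact d B
  /-- closed under weak isomorphisms -/
  weakIso : ∀ ⦃B B' : ChainComplex C ℕ⦄ (f : B ⟶ B'), IsDExact d B → IsDExact d B' →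
    IsWeakIso d f → (B ∈ E ↔ B' ∈ E)
  /-- the zero complex belongs to `E` -/
  zero_mem : ∀ B : ChainComplex C ℕ, (∀ i, IsZero (B.X i)) → B ∈ E
  inflation_comp : ∀ ⦃X Y Z : C⦄ (f : X ⟶ Y) (g : Y ⟶ Z),
    IsInflation d E f → IsInflation d E g → IsInflation d E (f ≫ g)
  deflation_comp : ∀ ⦃X Y Z : C⦄ (f : X ⟶ Y) (g : Y ⟶ Z),
    IsDeflation E f → IsDeflation E g → IsDeflation E (f ≫ g)
  /-- existence of `d`-pushouts along a morphism out of `B_{d+1}`, with the same `B_0` -/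
  pushout : ∀ B ∈ E, ∀ ⦃Y : C⦄ (g : B.X (d + 1) ⟶ Y),
    ∃ B' ∈ E, ∃ (f : B ⟶ B') (e : Y ≅ B'.X (d + 1)),
      f.f (d + 1) = g ≫ e.hom ∧ IsIso (f.f 0) ∧ IsDPushout d f
  /-- existence of `d`-pullbacks along a morphism into `B_0`, with the same `B_{d+1}` -/
  pullback : ∀ B ∈ E, ∀ ⦃Y : C⦄ (g : Y ⟶ B.X 0),
    ∃ B' ∈ E, ∃ (f : B' ⟶ B) (e : B'.X 0 ≅ Y),
      f.f 0 = e.hom ≫ g ∧ IsIso (f.f (d + 1)) ∧ IsDPullback d f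

end Sequences

/-! ### Subcategories -/

section Subcategories

variable {C : Type u} [Category.{v} C] [Preadditive C]

/-- The full subcategory `P` is closed under isomorphisms, finite direct sums (including the
zero object) and direct summands. -/
structure IsAdditiveSubcategory (P : ObjectProperty C) : Prop where
  of_iso : ∀ ⦃X Y : C⦄, (X ≅ Y) → P X → P Y
  zero : ∀ X : C, IsZero X → P X
  biprod : ∀ ⦃X Y : C⦄ (b : BinaryBicone X Y), Nonempty b.IsBilimit → P X → P Y → P b.pt
  summand : ∀ ⦃X Y : C⦄ (b : BinaryBicone X Y), Nonempty b.IsBilimit → P b.pt → P X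

/-- Each object has a right `P`-approximation. -/
def IsContravariantlyFinite (P : ObjectProperty C) : Prop :=
  ∀ Y : C, ∃ (X : C) (x : X ⟶ Y), P X ∧
    ∀ ⦃X' : C⦄, P X' → ∀ g : X' ⟶ Y, ∃ h : X' ⟶ X, h ≫ x = g

/-- Each object is the target of an `E`-admissible deflation from an object of `P`. -/
def IsGenerating (E : Set (ChainComplex C ℕ)) (P : ObjectProperty C) : Prop :=
  ∀ Y : C, ∃ (X : C) (x : X ⟶ Y), P X ∧ IsDeflation E x

/-- The functor `A ↦ C(-, A)|_P`. -/
noncomputable def restrictedYoneda (P : ObjectProperty C) :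
    C ⥤ (P.FullSubcategoryᵒᵖ ⥤ AddCommGrpCat.{v}) :=
  preadditiveYoneda ⋙ (Functor.whiskeringLeft _ _ _).obj P.ι.op

/-- The `P`-module `Coker (C(-, f)|_P)`. -/
noncomputable def cokerRestricted (P : ObjectProperty C) {X Y : C} (f : X ⟶ Y) :
    P.FullSubcategoryᵒᵖ ⥤ AddCommGrpCat.{v} :=
  cokernel ((restrictedYoneda P).map f)

/-- The relative structure `E_P`: the members `B` of `E` for which
`C(-, B_1)|_P ⟶ C(-, B_0)|_P` is an epimorphism. -/
def relative (E : Set (ChainComplex C ℕ)) (P : ObjectProperty C) : Set (ChainComplex C ℕ) :=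
  {B | B ∈ E ∧ Epi ((restrictedYoneda P).map (B.d 1 0))}

end Subcategories

end DExact

open DExact

/-!
Write `χ(A) = ∑ (-1)^i [A_i]` for the Euler characteristic of a bounded complex `A` in `C`. A
finitely presented `P`-module `M` has a resolution `C(-, A)|_P` with `A` left `d`-exact and `A_0`,
`A_1` in `P`: start from a presentation and take a `d`-kernel. The homomorphism sends `[M]` to
`χ(A)`. Maps of modules lift to such complexes (`exists_lift_of_presentation`), because `A_0` and
`A_1` lie in `P` and `A` is exact on all of `C` in higher degrees. The cone of a lift of an
isomorphism is acyclic on `P`, and the cone of a lift of a monomorphism resolves the cokernel. Hence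
independence of the resolution, the formula for all left `d`-exact sequences, and additivity on
short exact sequences all follow from one fact (`euler_eq_zero_of_acyclic`): in `K₀(C, E_P)`, a
bounded complex `D` for which `C(-, D)|_P` is acyclic has `χ(D) = 0`. Uniqueness is clear, as every
finitely presented module is the cokernel of the last morphism of a left `d`-exact sequence.

For that fact, note that `D_1 ⟶ D_0` is onto on `P`, so a deflation from an object of `P` factors
through it. By `IsDExactStructure.mem_of_factors` (the analogue of the obscure axiom of exact
categories) it is then the last morphism of some `B` in `E_P`. A lift `D ⟶ B` that is invertible in
degrees `0` and `1` has a cone which, up to contractible summands, is a complex that is again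
acyclic on `P` and shorter than `D`, as long as `D` has more than `d + 1` terms; since `χ(B) = 0`,
induction applies. When `D` has at most `d + 1` terms, the same cones together with the exactness of
`C(B, -)` show that `C(D, -)` is exact (`coexactAt_of_acyclic`). Then `D` is contractible, and as
`C` is idempotent complete `χ(D)` telescopes to zero (`euler_eq_zero_of_coexact`).
-/

namespace DExact

/-! ### Exactness of complexes under `C(W, -)` and `C(-, Z)` -/

section ChainComplexes

variable {C : Type u} [Category.{v} C] [Preadditive C]

/-- The sequence `C(-, D)` is exact in degree `n` on the objects satisfying `Q`. For `n = 0` the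
differential `D.d 0 0` vanishes, so this says that `C(-, D_1) ⟶ C(-, D_0)` is onto there. -/
def HomExactAt (Q : ObjectProperty C) (D : ChainComplex C ℕ) (n : ℕ) : Prop :=
  ∀ ⦃W : C⦄, Q W → ∀ z : W ⟶ D.X n, z ≫ D.d n (n - 1) = 0 →
    ∃ t : W ⟶ D.X (n + 1), t ≫ D.d (n + 1) n = z

/-- The sequence `C(D, -)` is exact in degree `n`. For `n = 0` the differential `D.d 0 0` vanishes,
so this says that `D_1 ⟶ D_0` is an epimorphism. -/
def CoexactAt (D : ChainComplex C ℕ) (n : ℕ) : Prop :=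
  ∀ ⦃Z : C⦄ (g : D.X n ⟶ Z), D.d (n + 1) n ≫ g = 0 →
    ∃ u : D.X (n - 1) ⟶ Z, D.d n (n - 1) ≫ u = g

lemma d_zero_zero (D : ChainComplex C ℕ) : D.d 0 0 = 0 := D.shape _ _ (by simp)

lemma HomExactAt.surj {Q : ObjectProperty C} {D : ChainComplex C ℕ} (h : HomExactAt Q D 0)
    {W : C} (hW : Q W) (z : W ⟶ D.X 0) : ∃ t : W ⟶ D.X 1, t ≫ D.d 1 0 = z :=
  h hW z (by simp)

lemma CoexactAt.eq_zero {D : ChainComplex C ℕ} (h : CoexactAt D 0) {Z : C} (g : D.X 0 ⟶ Z)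
    (hg : D.d 1 0 ≫ g = 0) : g = 0 := by
  obtain ⟨u, rfl⟩ := h g hg
  simp

lemma coexactAt_zero {D : ChainComplex C ℕ}
    (h : ∀ ⦃Z : C⦄ (g : D.X 0 ⟶ Z), D.d 1 0 ≫ g = 0 → g = 0) : CoexactAt D 0 :=
  fun _ g hg => ⟨0, by simp [h g hg]⟩

lemma IsLeftDExact.homExactAt {d : ℕ} {B : ChainComplex C ℕ} (h : IsLeftDExact d B)
    (Q : ObjectProperty C) (n : ℕ) : HomExactAt Q B (n + 1) := by
  intro W _ z hz
  by_cases hn : n ≤ d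
  · exact (h.exact W n hn z).1 hz
  · exact ⟨0, (h.isZero (n + 1) (by omega)).eq_of_tgt _ _⟩

lemma isLeftDExact_of_homExactAt {d : ℕ} {B : ChainComplex C ℕ}
    (h0 : ∀ i, d + 1 < i → IsZero (B.X i)) (h : ∀ n ≤ d, HomExactAt ⊤ B (n + 1)) :
    IsLeftDExact d B where
  isZero := h0
  exact Z i hi g := by
    refine ⟨fun hg => h i hi trivial g hg, ?_⟩
    rintro ⟨t, rfl⟩
    simp

lemma IsRightDExact.coexactAt {d : ℕ} {B : ChainComplex C ℕ} (h : IsRightDExact d B)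
    {n : ℕ} (hn : n ≤ d) : CoexactAt B n := by
  rcases n with _ | n
  · exact coexactAt_zero h.epi
  · intro Z g hg
    exact (h.exact Z n hn g).1 hg

lemma isRightDExact_of_coexactAt {d : ℕ} {B : ChainComplex C ℕ}
    (h0 : ∀ i, d + 1 < i → IsZero (B.X i)) (h : ∀ n ≤ d, CoexactAt B n) :
    IsRightDExact d B where
  isZero := h0
  epi _ g hg := (h 0 (Nat.zero_le _)).eq_zero g hg
  exact Z i hi g := by
    refine ⟨fun hg => h (i + 1) hi g hg, ?_⟩
    rintro ⟨t, rfl⟩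
    simp

/-- A commutative square in degrees `0` and `1` lifts to a chain map into a complex that is exact
in positive degrees on all objects. -/
lemma exists_lift {D B : ChainComplex C ℕ} (hB : ∀ n, HomExactAt ⊤ B (n + 1))
    (φ₀ : D.X 0 ⟶ B.X 0) (φ₁ : D.X 1 ⟶ B.X 1) (comm : φ₁ ≫ B.d 1 0 = D.d 1 0 ≫ φ₀) :
    ∃ φ : D ⟶ B, φ.f 0 = φ₀ ∧ φ.f 1 = φ₁ := by
  have key : ∀ (n : ℕ) (f : D.X n ⟶ B.X n) (f' : D.X (n + 1) ⟶ B.X (n + 1)),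
      f' ≫ B.d (n + 1) n = D.d (n + 1) n ≫ f →
        ∃ f'' : D.X (n + 2) ⟶ B.X (n + 2),
          f'' ≫ B.d (n + 2) (n + 1) = D.d (n + 2) (n + 1) ≫ f' := by
    intro n f f' hf
    exact hB n trivial (D.d (n + 2) (n + 1) ≫ f') (by simp [hf])
  choose s hs using key
  exact ⟨ChainComplex.mkHom D B φ₀ φ₁ comm fun n p => ⟨s n p.1 p.2.1 p.2.2, hs n p.1 p.2.1 p.2.2⟩,
    rfl, rfl⟩

/-- An endomorphism that vanishes in degrees `0` and `1` of a complex exact in positive degrees is,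
in each degree, a sum of terms factoring through the adjacent differentials. -/
lemma exists_homotopy {A : ChainComplex C ℕ} (hA : ∀ n, HomExactAt ⊤ A (n + 1)) (ε : A ⟶ A)
    (h0 : ε.f 0 = 0) (h1 : ε.f 1 = 0) (n : ℕ) :
    ∃ (s : A.X n ⟶ A.X (n + 1)) (t : A.X (n - 1) ⟶ A.X n),
      ε.f n = s ≫ A.d (n + 1) n + A.d n (n - 1) ≫ t := by
  induction n with
  | zero => exact ⟨0, 0, by simp [h0]⟩
  | succ n ih =>
    rcases n with _ | n
    · exact ⟨0, 0, by simp [h1]⟩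
    obtain ⟨s, t, hst⟩ := ih
    obtain ⟨s', hs'⟩ := hA (n + 1) trivial (ε.f (n + 2) - A.d (n + 2) (n + 1) ≫ s) (by
      change _ ≫ A.d (n + 2) (n + 1) = 0
      rw [Preadditive.sub_comp, ε.comm, hst]
      simp)
    exact ⟨s', s, by simp [hs']⟩

/-- If `C(-, A)` is exact in positive degrees and `φ : A ⟶ B` is invertible in degrees `0` and `1`,
then `φ` has a left inverse up to homotopy, so exactness of `C(B, -)` passes to `A`. -/
lemma CoexactAt.of_isIso {A B : ChainComplex C ℕ} (hA : ∀ n, HomExactAt ⊤ A (n + 1))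
    (φ : A ⟶ B) [IsIso (φ.f 0)] [IsIso (φ.f 1)] {n : ℕ}
    (h : CoexactAt B n) : CoexactAt A n := by
  obtain ⟨ψ, hψ0, hψ1⟩ := exists_lift (D := B) hA (inv (φ.f 0)) (inv (φ.f 1)) (by simp)
  intro Z g hg
  obtain ⟨s, t, hst⟩ := exists_homotopy hA (𝟙 A - φ ≫ ψ) (by simp [hψ0]) (by simp [hψ1]) n
  obtain ⟨u, hu⟩ := h (ψ.f n ≫ g) (by rw [← ψ.comm_assoc, hg, comp_zero])
  refine ⟨φ.f (n - 1) ≫ u + t ≫ g, ?_⟩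
  have := congrArg (· ≫ g) hst
  simp only [HomologicalComplex.sub_f_apply, HomologicalComplex.id_f, HomologicalComplex.comp_f,
    Preadditive.sub_comp, Preadditive.add_comp, Category.id_comp, Category.assoc, hg, comp_zero,
    zero_add, ← hu] at this
  rw [Preadditive.comp_add, ← this, ← φ.comm_assoc]
  simp

/-! ### Mapping cones -/

variable [HasBinaryBiproducts C]

/-- The terms `B_0`, `D_0 ⊞ B_1`, `D_1 ⊞ B_2`, … of the mapping cone of a map `D ⟶ B`. -/
noncomputable def coneX (D B : ChainComplex C ℕ) : ℕ → C
  | 0 => B.X 0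
  | n + 1 => D.X n ⊞ B.X (n + 1)

/-- The differentials of the mapping cone; the sign is on the differentials of `D`. -/
noncomputable def coneD {D B : ChainComplex C ℕ} (φ : D ⟶ B) :
    ∀ n, coneX D B (n + 1) ⟶ coneX D B n
  | 0 => (biprod.desc (φ.f 0) (B.d 1 0) : D.X 0 ⊞ B.X 1 ⟶ B.X 0)
  | n + 1 => (biprod.desc (biprod.lift (-D.d (n + 1) n) (φ.f (n + 1)))
      (B.d (n + 2) (n + 1) ≫ biprod.inr) : D.X (n + 1) ⊞ B.X (n + 2) ⟶ D.X n ⊞ B.X (n + 1))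

lemma coneD_comp {D B : ChainComplex C ℕ} (φ : D ⟶ B) :
    ∀ n, coneD φ (n + 1) ≫ coneD φ n = 0
  | 0 => by
    refine Eq.trans ?_ (rfl : (0 : D.X 1 ⊞ B.X 2 ⟶ B.X 0) = _)
    dsimp only [coneD, coneX]
    ext <;> simp
  | n + 1 => by
    refine Eq.trans ?_ (rfl : (0 : D.X (n + 2) ⊞ B.X (n + 3) ⟶ D.X n ⊞ B.X (n + 1)) = _)
    dsimp only [coneD, coneX]
    ext <;> simp

/-- The mapping cone of a chain map `φ : D ⟶ B`. -/
noncomputable def mapCone {D B : ChainComplex C ℕ} (φ : D ⟶ B) : ChainComplex C ℕ :=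
  ChainComplex.of (coneX D B) (coneD φ) (coneD_comp φ)

lemma mapCone_d {D B : ChainComplex C ℕ} (φ : D ⟶ B) (n : ℕ) :
    (mapCone φ).d (n + 1) n = coneD φ n :=
  ChainComplex.of_d _ _ n

namespace mapCone

variable {D B : ChainComplex C ℕ} (φ : D ⟶ B)

/-- The inclusion `D_n ⟶ D_n ⊞ B_{n+1}`. -/
noncomputable def inl (n : ℕ) : D.X n ⟶ (mapCone φ).X (n + 1) :=
  (biprod.inl : D.X n ⟶ D.X n ⊞ B.X (n + 1))

/-- The inclusion of `B_n` into degree `n` of the cone. -/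
noncomputable def inr : ∀ n : ℕ, B.X n ⟶ (mapCone φ).X n
  | 0 => 𝟙 (B.X 0)
  | n + 1 => (biprod.inr : B.X (n + 1) ⟶ D.X n ⊞ B.X (n + 1))

/-- The projection `D_n ⊞ B_{n+1} ⟶ D_n`. -/
noncomputable def fst (n : ℕ) : (mapCone φ).X (n + 1) ⟶ D.X n :=
  (biprod.fst : D.X n ⊞ B.X (n + 1) ⟶ D.X n)

/-- The projection of degree `n` of the cone onto `B_n`. -/
noncomputable def snd : ∀ n : ℕ, (mapCone φ).X n ⟶ B.X n
  | 0 => 𝟙 (B.X 0)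
  | n + 1 => (biprod.snd : D.X n ⊞ B.X (n + 1) ⟶ B.X (n + 1))

lemma inl_fst (n : ℕ) : inl φ n ≫ fst φ n = 𝟙 _ := biprod.inl_fst

lemma inl_snd (n : ℕ) : inl φ n ≫ snd φ (n + 1) = 0 := biprod.inl_snd

lemma inr_fst (n : ℕ) : inr φ (n + 1) ≫ fst φ n = 0 := biprod.inr_fst

lemma inr_snd : ∀ n : ℕ, inr φ n ≫ snd φ n = 𝟙 _
  | 0 => Category.id_comp (𝟙 (B.X 0))
  | _ + 1 => biprod.inr_snd

lemma snd_inr_zero : snd φ 0 ≫ inr φ 0 = 𝟙 _ := Category.id_comp (𝟙 (B.X 0))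

lemma total (n : ℕ) : fst φ n ≫ inl φ n + snd φ (n + 1) ≫ inr φ (n + 1) = 𝟙 _ := biprod.total

lemma inl_d_one : inl φ 0 ≫ (mapCone φ).d 1 0 = φ.f 0 ≫ inr φ 0 := by
  rw [mapCone_d]
  exact (biprod.inl_desc _ _).trans (Category.comp_id _).symm

lemma inr_d (n : ℕ) : inr φ (n + 1) ≫ (mapCone φ).d (n + 1) n = B.d (n + 1) n ≫ inr φ n := by
  rcases n with _ | n
  · rw [mapCone_d]
    exact (biprod.inr_desc _ _).trans (Category.comp_id _).symm
  · rw [mapCone_d]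
    exact biprod.inr_desc _ _

lemma inl_d_succ (n : ℕ) : inl φ (n + 1) ≫ (mapCone φ).d (n + 2) (n + 1) =
    φ.f (n + 1) ≫ inr φ (n + 1) - D.d (n + 1) n ≫ inl φ n := by
  rw [mapCone_d]
  refine (biprod.inl_desc _ _).trans ?_
  rw [biprod.lift_eq, Preadditive.neg_comp, neg_add_eq_sub]
  rfl

lemma inl_fst_assoc (n : ℕ) {Z : C} (h : D.X n ⟶ Z) : inl φ n ≫ fst φ n ≫ h = h := by
  rw [← Category.assoc, inl_fst, Category.id_comp]

lemma inr_fst_assoc (n : ℕ) {Z : C} (h : D.X n ⟶ Z) : inr φ (n + 1) ≫ fst φ n ≫ h = 0 := by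
  rw [← Category.assoc, inr_fst, zero_comp]

lemma inr_snd_assoc (n : ℕ) {Z : C} (h : B.X n ⟶ Z) : inr φ n ≫ snd φ n ≫ h = h := by
  rw [← Category.assoc, inr_snd, Category.id_comp]

lemma inl_d_one_assoc {Z : C} (h : (mapCone φ).X 0 ⟶ Z) :
    inl φ 0 ≫ (mapCone φ).d 1 0 ≫ h = φ.f 0 ≫ inr φ 0 ≫ h := by
  rw [← Category.assoc, inl_d_one, Category.assoc]

lemma inr_d_assoc (n : ℕ) {Z : C} (h : (mapCone φ).X n ⟶ Z) :
    inr φ (n + 1) ≫ (mapCone φ).d (n + 1) n ≫ h = B.d (n + 1) n ≫ inr φ n ≫ h := by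
  rw [← Category.assoc, inr_d, Category.assoc]

lemma inl_d_succ_assoc (n : ℕ) {Z : C} (h : (mapCone φ).X (n + 1) ⟶ Z) :
    inl φ (n + 1) ≫ (mapCone φ).d (n + 2) (n + 1) ≫ h =
      (φ.f (n + 1) ≫ inr φ (n + 1) - D.d (n + 1) n ≫ inl φ n) ≫ h := by
  rw [← Category.assoc, inl_d_succ]

lemma exists_eq_to {n : ℕ} {W : C} (z : W ⟶ (mapCone φ).X (n + 1)) :
    ∃ (y : W ⟶ D.X n) (t : W ⟶ B.X (n + 1)), z = y ≫ inl φ n + t ≫ inr φ (n + 1) :=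
  ⟨z ≫ fst φ n, z ≫ snd φ (n + 1), by
    simp only [Category.assoc, ← Preadditive.comp_add, total, Category.comp_id]⟩

lemma exists_eq_to_zero {W : C} (z : W ⟶ (mapCone φ).X 0) :
    ∃ t : W ⟶ B.X 0, z = t ≫ inr φ 0 :=
  ⟨z ≫ snd φ 0, by rw [Category.assoc, snd_inr_zero, Category.comp_id]⟩

lemma eq_zero_of_to {n : ℕ} {W : C} {y : W ⟶ D.X n} {t : W ⟶ B.X (n + 1)}
    (h : y ≫ inl φ n + t ≫ inr φ (n + 1) = 0) : y = 0 ∧ t = 0 := by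
  have h1 := congrArg (· ≫ fst φ n) h
  have h2 := congrArg (· ≫ snd φ (n + 1)) h
  simpa [inl_fst, inr_fst, inl_snd, inr_snd] using And.intro h1 h2

lemma homExactAt_zero {Q : ObjectProperty C}
    (h : ∀ ⦃W : C⦄, Q W → ∀ z : W ⟶ B.X 0, ∃ (y : W ⟶ D.X 0) (t : W ⟶ B.X 1),
      y ≫ φ.f 0 + t ≫ B.d 1 0 = z) : HomExactAt Q (mapCone φ) 0 := by
  intro W hW z _
  obtain ⟨z, rfl⟩ := exists_eq_to_zero φ z
  obtain ⟨y, t, rfl⟩ := h hW z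
  exact ⟨y ≫ inl φ 0 + t ≫ inr φ 1, by simp [inl_d_one, inr_d]⟩

lemma homExactAt_succ {Q : ObjectProperty C} {n : ℕ}
    (hD : ∀ ⦃W : C⦄, Q W → ∀ (y : W ⟶ D.X n) (t : W ⟶ B.X (n + 1)), y ≫ D.d n (n - 1) = 0 →
      y ≫ φ.f n + t ≫ B.d (n + 1) n = 0 → ∃ y' : W ⟶ D.X (n + 1), y' ≫ D.d (n + 1) n = y)
    (hB : HomExactAt Q B (n + 1)) : HomExactAt Q (mapCone φ) (n + 1) := by
  intro W hW z hz
  obtain ⟨y, t, rfl⟩ := exists_eq_to φ z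
  have h1 : y ≫ D.d n (n - 1) = 0 ∧ y ≫ φ.f n + t ≫ B.d (n + 1) n = 0 := by
    rcases n with _ | n
    · refine ⟨by simp, ?_⟩
      change _ ≫ (mapCone φ).d 1 0 = 0 at hz
      rw [Preadditive.add_comp, Category.assoc, Category.assoc, inl_d_one, inr_d,
        ← Category.assoc, ← Category.assoc, ← Preadditive.add_comp] at hz
      simpa [inr_snd] using congrArg (· ≫ snd φ 0) hz
    · have h : (-(y ≫ D.d (n + 1) n)) ≫ inl φ n +
          (y ≫ φ.f (n + 1) + t ≫ B.d (n + 2) (n + 1)) ≫ inr φ (n + 1) = 0 := by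
        rw [← hz]
        change _ = _ ≫ (mapCone φ).d (n + 2) (n + 1)
        simp only [Preadditive.add_comp, Preadditive.neg_comp, Category.assoc, inl_d_succ, inr_d,
          Preadditive.comp_sub]
        abel
      obtain ⟨h1, h2⟩ := eq_zero_of_to φ h
      exact ⟨neg_eq_zero.1 h1, h2⟩
  obtain ⟨y', hy'⟩ := hD hW y t h1.1 h1.2
  obtain ⟨t', ht'⟩ := hB hW (y' ≫ φ.f (n + 1) + t) (by
    change _ ≫ B.d (n + 1) n = 0
    rw [Preadditive.add_comp, Category.assoc, φ.comm, reassoc_of% hy', h1.2])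
  refine ⟨(-y') ≫ inl φ (n + 1) + t' ≫ inr φ (n + 2), ?_⟩
  simp only [Preadditive.add_comp, Preadditive.neg_comp, Category.assoc, inl_d_succ, inr_d,
    Preadditive.comp_sub, reassoc_of% ht', reassoc_of% hy']
  abel

lemma isZero {n : ℕ} (hD : IsZero (D.X n)) (hB : IsZero (B.X (n + 1))) :
    IsZero ((mapCone φ).X (n + 1)) := by
  change IsZero (D.X n ⊞ B.X (n + 1))
  rw [biprod_isZero_iff]
  exact ⟨hD, hB⟩

end mapCone

end ChainComplexes
/-! ### Euler characteristics of bounded complexes -/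

section Euler

variable {C : Type u} [Category.{v} C] [Preadditive C] {G : Type*} [AddCommGroup G]

/-- A function on objects with values in an abelian group is split additive if it respects the
relations that define the split Grothendieck group. -/
def IsSplitAdditive (c : C → G) : Prop :=
  ∀ S : ShortComplex C, Nonempty S.Splitting → c S.X₁ - c S.X₂ + c S.X₃ = 0

/-- The alternating sum of the values of `c` on the terms of `A` in degrees `< n`. -/
def euler (c : C → G) (A : ChainComplex C ℕ) (n : ℕ) : G :=
  ∑ i ∈ Finset.range n, (-1 : ℤ) ^ i • c (A.X i)

namespace IsSplitAdditive

variable {c : C → G}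

lemma of_isZero (hc : IsSplitAdditive c) {X : C} (hX : IsZero X) : c X = 0 := by
  simpa using hc (ShortComplex.mk (0 : X ⟶ X) (0 : X ⟶ X) (by simp))
    ⟨{ r := 0, s := 0, f_r := hX.eq_of_src _ _, s_g := hX.eq_of_src _ _, id := hX.eq_of_src _ _ }⟩

lemma of_splitting (hc : IsSplitAdditive c) {S : ShortComplex C} (s : S.Splitting) :
    c S.X₂ = c S.X₁ + c S.X₃ := by
  have := hc S ⟨s⟩
  rw [sub_add_eq_add_sub, sub_eq_zero] at this
  exact this.symm

lemma of_iso (hc : IsSplitAdditive c) [HasZeroObject C] {X Y : C} (e : X ≅ Y) : c X = c Y := by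
  obtain ⟨Z, hZ⟩ := HasZeroObject.zero (C := C)
  have h := hc.of_splitting (S := ShortComplex.mk e.hom (0 : Y ⟶ Z) (by simp))
    { r := e.inv, s := 0, f_r := by simp, s_g := hZ.eq_of_src _ _, id := by simp }
  simpa [hc.of_isZero hZ] using h.symm

lemma biprod (hc : IsSplitAdditive c) [HasBinaryBiproducts C] (X Y : C) : c (X ⊞ Y) = c X + c Y :=
  hc.of_splitting (ShortComplex.Splitting.ofHasBinaryBiproduct X Y)

end IsSplitAdditive

variable {c : C → G}

lemma euler_succ (A : ChainComplex C ℕ) (n : ℕ) :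
    euler c A (n + 1) = c (A.X 0) - euler c (ChainComplex.truncate.obj A) n := by
  simp [euler, Finset.sum_range_succ', pow_succ, add_comm, sub_eq_add_neg]

lemma euler_eq_of_isZero (hc : IsSplitAdditive c) {A : ChainComplex C ℕ} {n m : ℕ} (hnm : n ≤ m)
    (h : ∀ i, n ≤ i → IsZero (A.X i)) : euler c A m = euler c A n := by
  refine (Finset.sum_subset (Finset.range_mono hnm) fun i _ hi => ?_).symm
  rw [hc.of_isZero (h i (by simpa using hi)), smul_zero]

lemma euler_mapCone [HasBinaryBiproducts C] (hc : IsSplitAdditive c) {D B : ChainComplex C ℕ}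
    (φ : D ⟶ B) (n : ℕ) :
    euler c (mapCone φ) (n + 1) = euler c B (n + 1) - euler c D n := by
  have h : ∀ i, c ((mapCone φ).X (i + 1)) = c (D.X i) + c (B.X (i + 1)) :=
    fun i => hc.biprod (D.X i) (B.X (i + 1))
  have h0 : c ((mapCone φ).X 0) = c (B.X 0) := rfl
  simp only [euler, Finset.sum_range_succ', h, h0, smul_add, Finset.sum_add_distrib, pow_succ,
    mul_neg, mul_one, neg_smul, Finset.sum_neg_distrib]
  abel

/-- A bounded complex `A` with `C(A, -)` exact is contractible. -/
lemma exists_contraction {A : ChainComplex C ℕ} (hA : ∀ i, CoexactAt A i) {N : ℕ}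
    (hN : ∀ i, N ≤ i → IsZero (A.X i)) (i : ℕ) :
    ∃ (s : A.X i ⟶ A.X (i + 1)) (t : A.X (i - 1) ⟶ A.X i),
      s ≫ A.d (i + 1) i + A.d i (i - 1) ≫ t = 𝟙 (A.X i) := by
  rcases le_total N i with h | h
  · exact ⟨0, 0, (hN i h).eq_of_src _ _⟩
  induction h using Nat.decreasingInduction with
  | self => exact ⟨0, 0, (hN N le_rfl).eq_of_src _ _⟩
  | of_succ i _ ih =>
    obtain ⟨s, t, hst⟩ := ih
    change A.X i ⟶ A.X (i + 1) at t
    change _ + A.d (i + 1) i ≫ t = _ at hst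
    obtain ⟨u, hu⟩ := hA i (𝟙 _ - t ≫ A.d (i + 1) i) (by
      have := congrArg (· ≫ A.d (i + 1) i) hst
      simp only [Preadditive.add_comp, Category.assoc, Category.id_comp,
        HomologicalComplex.d_comp_d, comp_zero, zero_add] at this
      rw [Preadditive.comp_sub, Category.comp_id, this, sub_self])
    exact ⟨t, u, by rw [hu]; abel⟩

/-- Contractible complexes split into pieces `Y_n ⟶ A_n ⟶ Y_{n-1}`, where `Y_n` is the image of the
idempotent `s ≫ d`; the Euler characteristic telescopes. -/
lemma euler_eq_zero_of_coexact [HasZeroObject C] [IsIdempotentComplete C] (hc : IsSplitAdditive c)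
    {A : ChainComplex C ℕ} (hA : ∀ i, CoexactAt A i) {N : ℕ}
    (hN : ∀ i, N ≤ i → IsZero (A.X i)) : euler c A N = 0 := by
  choose s t hst using exists_contraction hA hN
  have hdt : ∀ i, A.d (i + 1) i ≫ t (i + 1) = 𝟙 _ - s (i + 1) ≫ A.d (i + 2) (i + 1) := by
    intro i
    rw [← hst (i + 1)]
    simp
  have hdsd : ∀ i, A.d (i + 1) i ≫ s i ≫ A.d (i + 1) i = A.d (i + 1) i := by
    intro i
    have := congrArg (A.d (i + 1) i ≫ ·) (hst i)
    simpa using this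
  have hdtd : ∀ i, A.d (i + 1) i ≫ t (i + 1) ≫ A.d (i + 1) i = A.d (i + 1) i := by
    intro i
    rw [reassoc_of% hdt i]
    simp
  have hidem : ∀ i, (s i ≫ A.d (i + 1) i) ≫ s i ≫ A.d (i + 1) i = s i ≫ A.d (i + 1) i := by
    intro i
    rw [Category.assoc, hdsd]
  choose Y j e hje hej using
    fun i => IsIdempotentComplete.idempotents_split (A.X i) _ (hidem i)
  have hj : ∀ i, j i ≫ s i ≫ A.d (i + 1) i = j i := by
    intro i
    rw [← hej, reassoc_of% hje i]
  have h0 : c (A.X 0) = c (Y 0) := by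
    refine hc.of_iso ⟨e 0, j 0, ?_, hje 0⟩
    rw [hej]
    simpa using hst 0
  have hsucc : ∀ i, c (A.X (i + 1)) = c (Y (i + 1)) + c (Y i) := by
    intro i
    have w : j (i + 1) ≫ A.d (i + 1) i ≫ e i = 0 := by
      rw [← hj]
      simp
    refine hc.of_splitting (S := ShortComplex.mk _ _ w)
      { r := e (i + 1), s := j i ≫ t (i + 1), f_r := hje _, s_g := ?_, id := ?_ }
    · dsimp
      rw [← hj i]
      simp only [Category.assoc, reassoc_of% hdtd i]
      rw [reassoc_of% hj i, hje]
    · dsimp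
      rw [hej, Category.assoc, reassoc_of% hej i, reassoc_of% hdsd i, hdt]
      abel
  have key : ∀ n, euler c A (n + 1) = (-1 : ℤ) ^ n • c (Y n) := by
    intro n
    induction n with
    | zero => simp [euler, h0]
    | succ n ih =>
      rw [euler, Finset.sum_range_succ, ← euler, ih, hsucc, pow_succ]
      simp
  rw [← euler_eq_of_isZero hc (Nat.le_succ N) hN, key, hc.of_isZero, smul_zero]
  rw [IsZero.iff_id_eq_zero, ← hje, (hN N le_rfl).eq_of_src (e N) 0, comp_zero]

end Euler
/-! ### Recognising members of a `d`-exact structure -/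

section Structure

variable {C : Type u} [Category.{v} C] [Preadditive C]

lemma CoexactAt.of_retract {A S : ChainComplex C ℕ} (r : Retract A S) {n : ℕ}
    (h : CoexactAt S n) : CoexactAt A n := by
  intro Z g hg
  obtain ⟨u, hu⟩ := h (r.r.f n ≫ g) (by rw [← r.r.comm_assoc, hg, comp_zero])
  refine ⟨r.i.f (n - 1) ≫ u, ?_⟩
  rw [← r.i.comm_assoc, hu, ← Category.assoc, ← HomologicalComplex.comp_f, r.retract,
    HomologicalComplex.id_f, Category.id_comp]

section Biprod

variable [HasBinaryBiproducts C]

lemma biprod_total_f (A T : ChainComplex C ℕ) (n : ℕ) :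
    (biprod.fst : A ⊞ T ⟶ A).f n ≫ (biprod.inl : A ⟶ A ⊞ T).f n +
      (biprod.snd : A ⊞ T ⟶ T).f n ≫ (biprod.inr : T ⟶ A ⊞ T).f n = 𝟙 _ := by
  simp only [← HomologicalComplex.comp_f, ← HomologicalComplex.add_f_apply, biprod.total,
    HomologicalComplex.id_f]

lemma HomExactAt.biprod {Q : ObjectProperty C} {A T : ChainComplex C ℕ} {n : ℕ}
    (hA : HomExactAt Q A n) (hT : HomExactAt Q T n) : HomExactAt Q (A ⊞ T) n := by
  intro W hW z hz
  obtain ⟨a, ha⟩ := hA hW (z ≫ (biprod.fst : A ⊞ T ⟶ A).f n) (by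
    rw [Category.assoc, HomologicalComplex.Hom.comm, reassoc_of% hz, zero_comp])
  obtain ⟨t, ht⟩ := hT hW (z ≫ (biprod.snd : A ⊞ T ⟶ T).f n) (by
    rw [Category.assoc, HomologicalComplex.Hom.comm, reassoc_of% hz, zero_comp])
  refine ⟨a ≫ (biprod.inl : A ⟶ A ⊞ T).f _ + t ≫ (biprod.inr : T ⟶ A ⊞ T).f _, ?_⟩
  rw [Preadditive.add_comp, Category.assoc, Category.assoc, HomologicalComplex.Hom.comm,
    HomologicalComplex.Hom.comm, reassoc_of% ha, reassoc_of% ht, ← Preadditive.comp_add,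
    biprod_total_f, Category.comp_id]

lemma CoexactAt.biprod {A T : ChainComplex C ℕ} {n : ℕ}
    (hA : CoexactAt A n) (hT : CoexactAt T n) : CoexactAt (A ⊞ T) n := by
  intro Z g hg
  obtain ⟨a, ha⟩ := hA ((biprod.inl : A ⟶ A ⊞ T).f n ≫ g) (by
    rw [← HomologicalComplex.Hom.comm_assoc, hg, comp_zero])
  obtain ⟨t, ht⟩ := hT ((biprod.inr : T ⟶ A ⊞ T).f n ≫ g) (by
    rw [← HomologicalComplex.Hom.comm_assoc, hg, comp_zero])
  refine ⟨(biprod.fst : A ⊞ T ⟶ A).f _ ≫ a + (biprod.snd : A ⊞ T ⟶ T).f _ ≫ t, ?_⟩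
  rw [Preadditive.comp_add, ← HomologicalComplex.Hom.comm_assoc,
    ← HomologicalComplex.Hom.comm_assoc, ha, ht, ← Category.assoc, ← Category.assoc,
    ← Preadditive.add_comp, biprod_total_f, Category.id_comp]

lemma isZero_biprod_X {A T : ChainComplex C ℕ} {n : ℕ} (hA : IsZero (A.X n))
    (hT : IsZero (T.X n)) : IsZero ((A ⊞ T).X n) := by
  rw [IsZero.iff_id_eq_zero, ← biprod_total_f, hA.eq_of_tgt (HomologicalComplex.Hom.f _ n) 0,
    hT.eq_of_tgt (HomologicalComplex.Hom.f _ n) 0]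
  simp

/-- The arrow `(A ⊞ T)_1 ⟶ (A ⊞ T)_0` is the direct sum of `A_1 ⟶ A_0` and `T_1 ⟶ T_0`. -/
noncomputable def biprodArrowIso (A T : ChainComplex C ℕ) :
    Arrow.mk ((A ⊞ T).d 1 0) ≅ Arrow.mk (biprod.map (A.d 1 0) (T.d 1 0)) :=
  Arrow.isoMk (HomologicalComplex.biprodXIso A T 1) (HomologicalComplex.biprodXIso A T 0) (by
    apply biprod.hom_ext <;> simp)

/-- Direct sums of isomorphic arrows are isomorphic. -/
noncomputable def arrowBiprodMapIso {X Y X' Y' Z W Z' W' : C} {f : X ⟶ Y} {f' : X' ⟶ Y'}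
    {g : Z ⟶ W} {g' : Z' ⟶ W'} (e : Arrow.mk f ≅ Arrow.mk f') (e' : Arrow.mk g ≅ Arrow.mk g') :
    Arrow.mk (biprod.map f g) ≅ Arrow.mk (biprod.map f' g') :=
  Arrow.isoMk (biprod.mapIso (Arrow.leftFunc.mapIso e) (Arrow.leftFunc.mapIso e'))
    (biprod.mapIso (Arrow.rightFunc.mapIso e) (Arrow.rightFunc.mapIso e')) (by
      have h := e.hom.w
      have h' := e'.hom.w
      dsimp at h h'
      change biprod.map e.hom.left e'.hom.left ≫ biprod.map f' g' =
        biprod.map f g ≫ biprod.map e.hom.right e'.hom.right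
      apply biprod.hom_ext' <;> simp [reassoc_of% h, reassoc_of% h'])

/-- After an automorphism of its source, `(h ≫ f, f) : X ⊞ Y ⟶ W` becomes `f` on `Y` and zero
on `X`. -/
noncomputable def arrowDescIso {X Y W Z : C} (h : X ⟶ Y) (f : Y ⟶ W) (hZ : IsZero Z) :
    Arrow.mk (biprod.desc (h ≫ f) f) ≅ Arrow.mk (biprod.map f (0 : X ⟶ Z)) :=
  Arrow.isoMk
    { hom := biprod.desc (biprod.lift h (𝟙 X)) biprod.inl
      inv := biprod.desc biprod.inr (biprod.lift (𝟙 X) (-h))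
      hom_inv_id := by apply biprod.hom_ext' <;> apply biprod.hom_ext <;> simp
      inv_hom_id := by apply biprod.hom_ext' <;> apply biprod.hom_ext <;> simp }
    { hom := biprod.inl
      inv := biprod.fst
      hom_inv_id := by simp
      inv_hom_id := by
        apply biprod.hom_ext
        · simp
        · exact hZ.eq_of_tgt _ _ }
    (by apply biprod.hom_ext' <;> apply biprod.hom_ext <;> simp)

end Biprod

/-! ### Complexes `Y = Y` -/

/-- A complex concentrated in degrees `n + 1` and `n` with invertible differential. -/
structure IsDisc (n : ℕ) (T : ChainComplex C ℕ) : Prop where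
  isZero : ∀ i, i ≠ n → i ≠ n + 1 → IsZero (T.X i)
  isIso : IsIso (T.d (n + 1) n)

lemma exists_isDisc [HasZeroObject C] (n : ℕ) (Y : C) :
    ∃ T : ChainComplex C ℕ, IsDisc n T ∧ Nonempty (T.X n ≅ Y) := by
  have hr : (ComplexShape.down ℕ).Rel (n + 1) n := rfl
  refine ⟨HomologicalComplex.double (𝟙 Y) hr, ⟨fun i h h' =>
    HomologicalComplex.isZero_double_X _ _ _ h' h, ?_⟩,
    ⟨HomologicalComplex.doubleXIso₁ (𝟙 Y) hr (by simp)⟩⟩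
  rw [HomologicalComplex.double_d _ _ (by simp)]
  infer_instance

namespace IsDisc

variable {n : ℕ} {T : ChainComplex C ℕ}

lemma homExactAt (h : IsDisc n T) (Q : ObjectProperty C) (i : ℕ) : HomExactAt Q T i := by
  have := h.isIso
  intro W _ z hz
  by_cases h1 : i = n
  · subst h1
    exact ⟨z ≫ inv (T.d (i + 1) i), by simp⟩
  by_cases h2 : i = n + 1
  · subst h2
    refine ⟨0, ?_⟩
    rw [← cancel_mono (T.d (n + 1) n)]
    simpa using hz.symm
  · exact ⟨0, (h.isZero i h1 h2).eq_of_tgt _ _⟩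

lemma coexactAt (h : IsDisc n T) (i : ℕ) : CoexactAt T i := by
  have := h.isIso
  intro Z g hg
  by_cases h1 : i = n
  · subst h1
    refine ⟨0, ?_⟩
    rw [← cancel_epi (T.d (i + 1) i)]
    simpa using hg.symm
  by_cases h2 : i = n + 1
  · subst h2
    exact ⟨inv (T.d (n + 1) n) ≫ g, by simp⟩
  · exact ⟨0, (h.isZero i h1 h2).eq_of_src _ _⟩

lemma isDExact (h : IsDisc n T) {d : ℕ} (hn : n ≤ d) : IsDExact d T :=
  have h0 : ∀ i, d + 1 < i → IsZero (T.X i) := fun i hi => h.isZero i (by omega) (by omega)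
  ⟨isLeftDExact_of_homExactAt h0 fun _ _ => h.homExactAt _ _,
    isRightDExact_of_coexactAt h0 fun _ _ => h.coexactAt _⟩

end IsDisc

lemma IsDExact.biprod [HasBinaryBiproducts C] {d : ℕ} {A T : ChainComplex C ℕ}
    (hA : IsDExact d A) (hT : IsDExact d T) : IsDExact d (A ⊞ T) :=
  have h0 : ∀ i, d + 1 < i → IsZero ((A ⊞ T).X i) :=
    fun i hi => isZero_biprod_X (hA.1.isZero i hi) (hT.1.isZero i hi)
  ⟨isLeftDExact_of_homExactAt h0 fun n _ => (hA.1.homExactAt _ n).biprod (hT.1.homExactAt _ n),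
    isRightDExact_of_coexactAt h0 fun _ hn => (hA.2.coexactAt hn).biprod (hT.2.coexactAt hn)⟩

/-! ### Deflations -/

lemma IsDeflation.of_arrow_iso {E : Set (ChainComplex C ℕ)} {X Y X' Y' : C} {f : X ⟶ Y}
    {f' : X' ⟶ Y'} (h : IsDeflation E f) (e : Arrow.mk f ≅ Arrow.mk f') : IsDeflation E f' := by
  obtain ⟨B, hB, ⟨e'⟩⟩ := h
  exact ⟨B, hB, ⟨e' ≪≫ e⟩⟩

namespace IsDExactStructure

variable {d : ℕ} {E : Set (ChainComplex C ℕ)}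

/-- The case of `weakIso` in which the consecutive degrees are `d + 1` and `0`. -/
lemma mem_iff_of_isIso_ends (hE : IsDExactStructure d E) {A B : ChainComplex C ℕ}
    (hA : IsDExact d A) (hB : IsDExact d B) (f : A ⟶ B) (h : IsIso (f.f (d + 1)))
    (h0 : IsIso (f.f 0)) : A ∈ E ↔ B ∈ E :=
  hE.weakIso f hA hB ⟨d + 1, le_rfl, h, by rwa [show d + 1 + 1 = d + 2 from rfl, Nat.mod_self]⟩

/-- Membership of a left `d`-exact sequence in `E` depends on its last morphism only. -/
lemma mem_of_isDeflation (hE : IsDExactStructure d E) {A : ChainComplex C ℕ}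
    (hA : IsLeftDExact d A) (h : IsDeflation E (A.d 1 0)) : A ∈ E := by
  obtain ⟨B, hB, ⟨e⟩⟩ := h
  have hB' := hE.isDExact B hB
  obtain ⟨φ, h0, h1⟩ := exists_lift (D := A) (hB'.1.homExactAt ⊤) e.inv.right e.inv.left
    e.inv.w
  have i0 : IsIso (φ.f 0) := by rw [h0]; infer_instance
  have i1 : IsIso (φ.f 1) := by rw [h1]; infer_instance
  have hA' : IsDExact d A := ⟨hA, isRightDExact_of_coexactAt hA.isZero fun n hn =>
    (hB'.2.coexactAt hn).of_isIso (hA.homExactAt ⊤) φ⟩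
  refine (hE.weakIso φ hA' hB' ⟨0, Nat.zero_le _, i0, ?_⟩).2 hB
  rwa [Nat.mod_eq_of_lt (by omega)]

/-- Adding a summand `Y = Y` in degrees `1` and `0`: the result is weakly isomorphic to the pullback
along the projection `B_0 ⊞ Y ⟶ B_0`. -/
lemma biprod_disc_mem [HasBinaryBiproducts C] (hE : IsDExactStructure d E) (hd : 1 ≤ d)
    {B T : ChainComplex C ℕ} (hB : B ∈ E) (hT : IsDisc 0 T) : (B ⊞ T) ∈ E := by
  obtain ⟨B', hB', φ, e, hφ0, hφ, -⟩ := hE.pullback B hB ((biprod.fst : B ⊞ T ⟶ B).f 0)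
  have := hT.isIso
  obtain ⟨ψ, hψ0, -⟩ := exists_lift (D := B') (fun n => hT.homExactAt ⊤ (n + 1))
    (e.hom ≫ (biprod.snd : B ⊞ T ⟶ T).f 0)
    (B'.d 1 0 ≫ (e.hom ≫ (biprod.snd : B ⊞ T ⟶ T).f 0) ≫ inv (T.d 1 0)) (by simp)
  have hBT := (hE.isDExact B hB).biprod (hT.isDExact (Nat.zero_le d))
  refine (hE.mem_iff_of_isIso_ends (hE.isDExact B' hB') hBT (biprod.lift φ ψ) ?_ ?_).1 hB'
  · have hz : IsZero (T.X (d + 1)) := hT.isZero _ (by omega) (by omega)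
    refine ⟨(biprod.fst : B ⊞ T ⟶ B).f (d + 1) ≫ inv (φ.f (d + 1)), ?_, ?_⟩
    · rw [← Category.assoc, ← HomologicalComplex.comp_f, biprod.lift_fst, IsIso.hom_inv_id]
    · have h1 : (biprod.lift φ ψ).f (d + 1) =
          φ.f (d + 1) ≫ (biprod.inl : B ⟶ B ⊞ T).f (d + 1) := by
        rw [biprod.lift_eq, HomologicalComplex.add_f_apply, HomologicalComplex.comp_f,
          HomologicalComplex.comp_f, hz.eq_of_tgt (ψ.f (d + 1)) 0, zero_comp, add_zero]
      have h2 := biprod_total_f B T (d + 1)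
      rw [hz.eq_of_tgt ((biprod.snd : B ⊞ T ⟶ T).f (d + 1)) 0, zero_comp, add_zero] at h2
      rw [h1, Category.assoc, IsIso.inv_hom_id_assoc, h2]
  · have h1 : (biprod.lift φ ψ).f 0 = e.hom := by
      rw [biprod.lift_eq, HomologicalComplex.add_f_apply, HomologicalComplex.comp_f,
        HomologicalComplex.comp_f, hφ0, hψ0, Category.assoc, Category.assoc,
        ← Preadditive.comp_add, biprod_total_f, Category.comp_id]
    rw [h1]
    infer_instance

/-- The sequence `Y = Y ⟶ 0` in degrees `2`, `1`, `0` belongs to `E`: for `d = 1` it is a pushout of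
the zero complex, and for `d > 1` it is weakly isomorphic to the zero complex. -/
lemma disc_one_mem [HasZeroObject C] (hE : IsDExactStructure d E) (hd : 1 ≤ d)
    {T : ChainComplex C ℕ} (hT : IsDisc 1 T) : T ∈ E := by
  obtain ⟨O, hO⟩ : ∃ O : ChainComplex C ℕ, IsZero O := HasZeroObject.zero
  have hO' : ∀ i, IsZero (O.X i) := fun i =>
    (HomologicalComplex.eval C (ComplexShape.down ℕ) i).map_isZero hO
  have hOE : O ∈ E := hE.zero_mem O hO'
  have hT0 : IsZero (T.X 0) := hT.isZero 0 (by omega) (by omega)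
  rcases hd.eq_or_lt with rfl | hd
  · obtain ⟨B, hB, f, e, -, hf0, -⟩ := hE.pushout O hOE (0 : O.X 2 ⟶ T.X 2)
    have hB0 : IsZero (B.X 0) := (hO' 0).of_iso (asIso (f.f 0)).symm
    have hB' := hE.isDExact B hB
    have := hT.isIso
    obtain ⟨φ, -, h1⟩ := exists_lift (D := T) (hB'.1.homExactAt ⊤) 0
      (inv (T.d 2 1) ≫ e.hom ≫ B.d 2 1) (hB0.eq_of_tgt _ _)
    have h2 : φ.f 2 = e.hom := by
      rw [← sub_eq_zero]
      obtain ⟨t, ht⟩ := hB'.1.homExactAt ⊤ 1 trivial (φ.f 2 - e.hom) (by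
        change _ ≫ B.d 2 1 = 0
        rw [Preadditive.sub_comp, φ.comm, h1, IsIso.hom_inv_id_assoc, sub_self])
      rw [← ht, (hB'.1.isZero 3 (by omega)).eq_of_tgt t 0, zero_comp]
    refine (hE.mem_iff_of_isIso_ends (hT.isDExact le_rfl) hB' φ ?_ ?_).2 hB
    · change IsIso (φ.f 2)
      rw [h2]
      infer_instance
    · exact hT0.isIso hB0 _
  · have hTd : IsZero (T.X (d + 1)) := hT.isZero _ (by omega) (by omega)
    exact (hE.mem_iff_of_isIso_ends (hE.isDExact O hOE) (hT.isDExact hd.le) 0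
      ((hO' _).isIso hTd _) ((hO' _).isIso hT0 _)).1 hOE

/-- A left `d`-exact sequence belongs to `E` as soon as some deflation factors through its last
morphism `f : A_1 ⟶ A_0`. If `h ≫ f` is a deflation from `X`, then `(h ≫ f, f) : X ⊞ A_1 ⟶ A_0` is
a composite of deflations; as it is isomorphic to `(0, f)`, the direct sum of `A` and `X = X ⟶ 0`
belongs to `E`, and pushing out along a projection removes the extra summand. -/
lemma mem_of_factors [HasBinaryBiproducts C] [HasZeroObject C] (hE : IsDExactStructure d E)
    (hd : 1 ≤ d) {A : ChainComplex C ℕ} (hA : IsLeftDExact d A) {X : C} (h : X ⟶ A.X 1)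
    (hx : IsDeflation E (h ≫ A.d 1 0)) : A ∈ E := by
  obtain ⟨T, hT, ⟨eT⟩⟩ := exists_isDisc 0 (A.X 1)
  obtain ⟨T₀, hT₀, ⟨eT₀⟩⟩ := exists_isDisc 0 (A.X 0)
  obtain ⟨T₁, hT₁, ⟨eT₁⟩⟩ := exists_isDisc 1 (A.X 1)
  obtain ⟨S, hS, ⟨eS⟩⟩ := exists_isDisc 1 X
  have := hT.isIso
  have := hT₀.isIso
  -- `(h ≫ f, f)` is, up to the order of the summands, `1 ⊞ (h ≫ f)` followed by `(f, 1)`.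
  have hu : IsDeflation E (biprod.map (𝟙 (A.X 1)) (h ≫ A.d 1 0)) := by
    obtain ⟨B, hB, ⟨e⟩⟩ := hx
    have hBT : IsDeflation E (biprod.map (h ≫ A.d 1 0) (𝟙 (A.X 1))) :=
      ⟨_, hE.biprod_disc_mem hd hB hT, ⟨biprodArrowIso B T ≪≫ arrowBiprodMapIso e
        (Arrow.isoMk (asIso (T.d 1 0) ≪≫ eT) eT (by simp))⟩⟩
    exact hBT.of_arrow_iso (Arrow.isoMk (biprod.braiding _ _) (biprod.braiding _ _)
      (by apply biprod.hom_ext <;> simp))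
  have hv : IsDeflation E (biprod.desc (A.d 1 0 ≫ 𝟙 (A.X 0)) (𝟙 (A.X 0))) := by
    have hT₁0 : IsZero (T₁.X 0) := hT₁.isZero 0 (by omega) (by omega)
    have hTT : IsDeflation E (biprod.map (0 : A.X 1 ⟶ T₁.X 0) (𝟙 (A.X 0))) :=
      ⟨_, hE.biprod_disc_mem hd (hE.disc_one_mem hd hT₁) hT₀,
        ⟨biprodArrowIso T₁ T₀ ≪≫ arrowBiprodMapIso
          (Arrow.isoMk eT₁ (Iso.refl _) (hT₁0.eq_of_tgt _ _))
          (Arrow.isoMk (asIso (T₀.d 1 0) ≪≫ eT₀) eT₀ (by simp))⟩⟩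
    refine (hTT.of_arrow_iso (Arrow.isoMk (biprod.braiding _ _) (biprod.braiding _ _)
      (by apply biprod.hom_ext <;> simp))).of_arrow_iso
        (arrowDescIso (A.d 1 0) (𝟙 (A.X 0)) hT₁0).symm
  have huv : IsDeflation E (biprod.desc (h ≫ A.d 1 0) (A.d 1 0)) := by
    refine (hE.deflation_comp _ _ hu hv).of_arrow_iso
      (Arrow.isoMk (biprod.braiding _ _) (Iso.refl _) ?_)
    apply biprod.hom_ext' <;> simp
  have hS0 : IsZero (S.X 0) := hS.isZero 0 (by omega) (by omega)
  have hS' := hS.isDExact hd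
  have h0 : ∀ i, d + 1 < i → IsZero ((A ⊞ S).X i) :=
    fun i hi => isZero_biprod_X (hA.isZero i hi) (hS'.1.isZero i hi)
  have hASl : IsLeftDExact d (A ⊞ S) := isLeftDExact_of_homExactAt h0 fun n _ =>
    (hA.homExactAt _ n).biprod (hS'.1.homExactAt _ n)
  have hAS : (A ⊞ S) ∈ E := by
    refine hE.mem_of_isDeflation hASl (huv.of_arrow_iso ?_)
    exact arrowDescIso h (A.d 1 0) hS0 ≪≫ arrowBiprodMapIso (Iso.refl _)
      (Arrow.isoMk eS.symm (Iso.refl _) (hS0.eq_of_tgt _ _)) ≪≫ (biprodArrowIso A S).symm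
  have hA' : IsDExact d A := ⟨hA, isRightDExact_of_coexactAt hA.isZero fun n hn =>
    CoexactAt.of_retract ⟨biprod.inl, biprod.fst, by simp⟩
      ((hE.isDExact _ hAS).2.coexactAt hn)⟩
  -- The composite `A ⟶ A ⊞ S ⟶ B` is invertible in degrees `d + 1` and `0`.
  obtain ⟨B, hB, f, e, hf, hf0, -⟩ :=
    hE.pushout _ hAS ((biprod.fst : A ⊞ S ⟶ A).f (d + 1))
  refine (hE.mem_iff_of_isIso_ends hA' (hE.isDExact B hB) (biprod.inl ≫ f) ?_ ?_).2 hB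
  · rw [HomologicalComplex.comp_f, hf, ← Category.assoc, HomologicalComplex.biprod_inl_fst_f,
      Category.id_comp]
    infer_instance
  · rw [HomologicalComplex.comp_f]
    have : IsIso ((biprod.inl : A ⟶ A ⊞ S).f 0) := by
      refine ⟨(biprod.fst : A ⊞ S ⟶ A).f 0, by simp, ?_⟩
      have h2 := biprod_total_f A S 0
      rwa [hS0.eq_of_tgt ((biprod.snd : A ⊞ S ⟶ S).f 0) 0, zero_comp, add_zero] at h2
    infer_instance

end IsDExactStructure

end Structure
/-! ### Complexes that are acyclic on a generating subcategory -/

section Acyclic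

variable {C : Type u} [Category.{v} C] [Preadditive C]

lemma epi_restrictedYoneda_map_iff (P : ObjectProperty C) {X Y : C} (f : X ⟶ Y) :
    Epi ((restrictedYoneda P).map f) ↔
      ∀ ⦃W : C⦄, P W → ∀ z : W ⟶ Y, ∃ t : W ⟶ X, t ≫ f = z := by
  rw [NatTrans.epi_iff_epi_app]
  constructor
  · intro h W hW z
    exact (AddCommGrpCat.epi_iff_surjective _).1 (h (Opposite.op ⟨W, hW⟩)) z
  · intro h W
    exact (AddCommGrpCat.epi_iff_surjective _).2 fun z => h W.unop.property z

lemma CoexactAt.of_isZero {D : ChainComplex C ℕ} {n : ℕ} (h : IsZero (D.X n)) : CoexactAt D n :=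
  fun _ _ _ => ⟨0, h.eq_of_src _ _⟩

section ShiftedCone

variable [HasBinaryBiproducts C]

lemma mapCone.hom_ext_from {D B : ChainComplex C ℕ} (φ : D ⟶ B) {n : ℕ} {Z : C}
    {f g : (mapCone φ).X (n + 1) ⟶ Z} (h : mapCone.inl φ n ≫ f = mapCone.inl φ n ≫ g)
    (h' : mapCone.inr φ (n + 1) ≫ f = mapCone.inr φ (n + 1) ≫ g) : f = g := by
  rw [← Category.id_comp f, ← Category.id_comp g, ← mapCone.total]
  simp [h, h']

lemma mapCone.eq_zero_of_coexactAt {D B : ChainComplex C ℕ} (φ : D ⟶ B)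
    (h : CoexactAt (mapCone φ) 0) {Z : C} (g : B.X 0 ⟶ Z) (hD : φ.f 0 ≫ g = 0)
    (hB : B.d 1 0 ≫ g = 0) : g = 0 := by
  have h0 : mapCone.snd φ 0 ≫ g = 0 := h.eq_zero _ (by
    refine mapCone.hom_ext_from _ ?_ ?_
    · rw [mapCone.inl_d_one_assoc, mapCone.inr_snd_assoc, hD, comp_zero]
    · rw [mapCone.inr_d_assoc, mapCone.inr_snd_assoc, hB, comp_zero])
  rw [← mapCone.inr_snd_assoc φ 0 g, h0, comp_zero]

lemma mapCone.exists_of_coexactAt {D B : ChainComplex C ℕ} (φ : D ⟶ B) {n : ℕ}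
    (h : CoexactAt (mapCone φ) (n + 1)) {Z : C} (g : D.X n ⟶ Z) (hg : D.d (n + 1) n ≫ g = 0) :
    ∃ (u : B.X n ⟶ Z) (v : D.X (n - 1) ⟶ Z), B.d (n + 1) n ≫ u = 0 ∧
      φ.f n ≫ u - D.d n (n - 1) ≫ v = g := by
  obtain ⟨v, hv⟩ := h (mapCone.fst φ n ≫ g) (by
    refine mapCone.hom_ext_from _ ?_ ?_
    · rw [mapCone.inl_d_succ_assoc, Preadditive.sub_comp, Category.assoc, Category.assoc,
        mapCone.inr_fst_assoc, mapCone.inl_fst_assoc, hg]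
      simp
    · rw [mapCone.inr_d_assoc, mapCone.inr_fst_assoc]
      simp)
  change (mapCone φ).X n ⟶ Z at v
  change (mapCone φ).d (n + 1) n ≫ v = _ at hv
  have hu : B.d (n + 1) n ≫ mapCone.inr φ n ≫ v = 0 := by
    rw [← mapCone.inr_d_assoc, hv, mapCone.inr_fst_assoc]
  have hg' : mapCone.inl φ n ≫ (mapCone φ).d (n + 1) n ≫ v = g := by
    rw [hv, mapCone.inl_fst_assoc]
  rcases n with _ | n
  · refine ⟨_, 0, hu, ?_⟩
    rw [← hg', mapCone.inl_d_one_assoc, comp_zero, sub_zero]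
  · refine ⟨_, mapCone.inl φ n ≫ v, hu, ?_⟩
    rw [← hg', mapCone.inl_d_succ_assoc, Preadditive.sub_comp, Category.assoc, Category.assoc]
    rfl

/-- The mapping cone `⋯ ⟶ D_3 ⊞ B_4 ⟶ D_2 ⊞ B_3 ⟶ B_2` of the part of `φ` in degrees `≥ 2`. -/
noncomputable abbrev shiftedCone {D B : ChainComplex C ℕ} (φ : D ⟶ B) : ChainComplex C ℕ :=
  mapCone (ChainComplex.truncate.map (ChainComplex.truncate.map φ))

/-- When `φ` is invertible in degrees `0` and `1`, the cone of `φ` differs from `shiftedCone φ` by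
contractible pieces, so it inherits acyclicity. -/
lemma shiftedCone_homExactAt {Q : ObjectProperty C} {D B : ChainComplex C ℕ} (φ : D ⟶ B)
    [IsIso (φ.f 0)] [IsIso (φ.f 1)] (hD : ∀ n, HomExactAt Q D n)
    (hB : ∀ n, HomExactAt ⊤ B (n + 1)) (n : ℕ) : HomExactAt Q (shiftedCone φ) n := by
  rcases n with _ | n
  · refine mapCone.homExactAt_zero _ fun W hW z => ?_
    change W ⟶ B.X 2 at z
    obtain ⟨y, hy⟩ := hD 1 hW (z ≫ B.d 2 1 ≫ inv (φ.f 1)) (by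
      change _ ≫ D.d 1 0 = 0
      rw [← cancel_mono (φ.f 0), zero_comp, Category.assoc, Category.assoc, Category.assoc,
        ← φ.comm, IsIso.inv_hom_id_assoc, B.d_comp_d, comp_zero])
    obtain ⟨t, ht⟩ := hB 1 trivial (z - y ≫ φ.f 2) (by
      change _ ≫ B.d 2 1 = 0
      rw [Preadditive.sub_comp, Category.assoc, φ.comm, reassoc_of% hy]
      simp)
    exact ⟨y, t, by
      change y ≫ φ.f 2 + t ≫ B.d 3 2 = z
      rw [ht, add_sub_cancel]⟩
  · refine mapCone.homExactAt_succ _ (fun W hW y t hy hyt => ?_)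
      (fun W _ z hz => hB (n + 2) trivial z hz)
    change W ⟶ D.X (n + 2) at y
    change W ⟶ B.X (n + 3) at t
    change y ≫ φ.f (n + 2) + t ≫ B.d (n + 3) (n + 2) = 0 at hyt
    refine hD (n + 2) hW y ?_
    rcases n with _ | n
    · change y ≫ D.d 2 1 = 0
      have := congrArg (· ≫ B.d 2 1) hyt
      rw [← cancel_mono (φ.f 1), zero_comp, Category.assoc, ← φ.comm]
      simpa using this
    · exact hy

/-- If `φ : D ⟶ B` is invertible in degrees `0` and `1`, coexactness of `B` in a degree passes to `D`
once the shifted cone, whose degree `n` receives `D_{n+1}`, is coexact one degree lower. -/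
lemma CoexactAt.of_shiftedCone {D B : ChainComplex C ℕ} (φ : D ⟶ B) [IsIso (φ.f 0)]
    [IsIso (φ.f 1)] {n : ℕ} (hB : CoexactAt B (n + 1)) (h : CoexactAt (shiftedCone φ) n) :
    CoexactAt D (n + 1) := by
  intro Z g hg
  rcases n with _ | n
  · have h0 : B.d 2 1 ≫ inv (φ.f 1) ≫ g = 0 := mapCone.eq_zero_of_coexactAt _ h _
      (by
        change φ.f 2 ≫ B.d 2 1 ≫ inv (φ.f 1) ≫ g = 0
        rw [φ.comm_assoc, IsIso.hom_inv_id_assoc, hg])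
      (by
        change B.d 3 2 ≫ B.d 2 1 ≫ inv (φ.f 1) ≫ g = 0
        simp)
    obtain ⟨u, hu⟩ := hB (inv (φ.f 1) ≫ g) h0
    change B.X 0 ⟶ Z at u
    change B.d 1 0 ≫ u = _ at hu
    refine ⟨φ.f 0 ≫ u, ?_⟩
    change D.d 1 0 ≫ _ = _
    rw [← φ.comm_assoc, hu, IsIso.hom_inv_id_assoc]
  · obtain ⟨u, v, hu, huv⟩ := mapCone.exists_of_coexactAt _ h g hg
    change B.X (n + 2) ⟶ Z at u
    obtain ⟨w, hw⟩ := hB u hu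
    change B.X (n + 1) ⟶ Z at w
    change B.d (n + 2) (n + 1) ≫ w = u at hw
    rcases n with _ | n
    · have hv : φ.f 2 ≫ u = g := by
        rw [← huv]
        exact (sub_eq_self.2 ((congrArg (· ≫ v) (d_zero_zero _)).trans zero_comp)).symm
      refine ⟨φ.f 1 ≫ w, ?_⟩
      change D.d 2 1 ≫ _ = g
      rw [← φ.comm_assoc, hw, hv]
    · change D.X (n + 2) ⟶ Z at v
      change φ.f (n + 3) ≫ u - D.d (n + 3) (n + 2) ≫ v = g at huv
      refine ⟨φ.f (n + 2) ≫ w - v, ?_⟩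
      change D.d (n + 3) (n + 2) ≫ _ = g
      rw [Preadditive.comp_sub, ← φ.comm_assoc, hw, huv]

end ShiftedCone

variable [HasBinaryBiproducts C] [HasZeroObject C] {d : ℕ} {E : Set (ChainComplex C ℕ)}
  {P : ObjectProperty C}

/-- If `C(-, D_1) ⟶ C(-, D_0)` is onto on `P`, then `D_1 ⟶ D_0` is the last morphism of a member of
the relative structure. -/
lemma exists_relative (hd : 1 ≤ d) (hE : IsDExactStructure d E) (hker : HasDKernels C d)
    (hgen : IsGenerating E P) {D : ChainComplex C ℕ} (hD : HomExactAt P D 0) :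
    ∃ B ∈ relative E P, ∃ φ : D ⟶ B, IsIso (φ.f 0) ∧ IsIso (φ.f 1) := by
  obtain ⟨B, hB, ⟨e⟩⟩ := hker (D.d 1 0)
  obtain ⟨φ, h0, h1⟩ := exists_lift (D := D) (hB.homExactAt ⊤) e.inv.right e.inv.left e.inv.w
  have i0 : IsIso (φ.f 0) := by rw [h0]; infer_instance
  have i1 : IsIso (φ.f 1) := by rw [h1]; infer_instance
  have hsurj : ∀ ⦃W : C⦄, P W → ∀ z : W ⟶ B.X 0, ∃ t : W ⟶ B.X 1, t ≫ B.d 1 0 = z := by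
    intro W hW z
    obtain ⟨t, ht⟩ := hD.surj hW (z ≫ inv (φ.f 0))
    exact ⟨t ≫ φ.f 1, by rw [Category.assoc, φ.comm, reassoc_of% ht, IsIso.inv_hom_id,
      Category.comp_id]⟩
  -- A deflation from an object of `P` factors through `B_1 ⟶ B_0`.
  obtain ⟨X, x, hX, hx⟩ := hgen (B.X 0)
  obtain ⟨t, rfl⟩ := hsurj hX x
  exact ⟨B, ⟨hE.mem_of_factors hd hB t hx, (epi_restrictedYoneda_map_iff P _).2 hsurj⟩, φ, i0, i1⟩

/-- Modules vanishing on `P` have no extensions by representables in degrees `≤ d`; for a complex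
that is acyclic on `P` this means that `C(D, -)` is exact in degrees `≤ d`. -/
lemma coexactAt_of_acyclic (hd : 1 ≤ d) (hE : IsDExactStructure d E) (hker : HasDKernels C d)
    (hgen : IsGenerating E P) {n : ℕ} (hn : n ≤ d) {D : ChainComplex C ℕ}
    (hD : ∀ m, HomExactAt P D m) : CoexactAt D n := by
  induction n generalizing D with
  | zero =>
    obtain ⟨B, hB, φ, i0, i1⟩ := exists_relative hd hE hker hgen (hD 0)
    refine coexactAt_zero fun Z g hg => ?_
    have := (hE.isDExact B hB.1).2.epi Z (inv (φ.f 0) ≫ g) (by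
      rw [← cancel_epi (φ.f 1), φ.comm_assoc]
      simp [hg])
    simpa using this
  | succ n ih =>
    obtain ⟨B, hB, φ, i0, i1⟩ := exists_relative hd hE hker hgen (hD 0)
    have hB' := hE.isDExact B hB.1
    exact CoexactAt.of_shiftedCone φ (hB'.2.coexactAt hn)
      (ih (by omega) (shiftedCone_homExactAt φ hD (hB'.1.homExactAt ⊤)))

variable [IsIdempotentComplete C] {G : Type*} [AddCommGroup G] {c : C → G}

/-- The relations of `K₀(C, E_P)` kill the Euler characteristic of every bounded complex that is
acyclic on `P`. A complex with at most `d + 1` terms is contractible; a longer one is shortened by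
splitting off a member of `E_P` with the same last morphism. -/
lemma euler_eq_zero_of_acyclic (hd : 1 ≤ d) (hE : IsDExactStructure d E)
    (hker : HasDKernels C d) (hgen : IsGenerating E P) (hc : IsSplitAdditive c)
    (hrel : ∀ B ∈ relative E P, euler c B (d + 2) = 0) {N : ℕ} {D : ChainComplex C ℕ}
    (hD : ∀ m, HomExactAt P D m) (hN : ∀ i, N ≤ i → IsZero (D.X i)) : euler c D N = 0 := by
  induction N generalizing D with
  | zero => rfl
  | succ N ih =>
    by_cases hNd : N ≤ d
    · refine euler_eq_zero_of_coexact hc (fun i => ?_) hN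
      by_cases hi : i ≤ d
      · exact coexactAt_of_acyclic hd hE hker hgen hi hD
      · exact CoexactAt.of_isZero (hN i (by omega))
    obtain ⟨M, rfl⟩ : ∃ M, N = M + 1 := ⟨N - 1, by omega⟩
    obtain ⟨B, hB, φ, i0, i1⟩ := exists_relative hd hE hker hgen (hD 0)
    have hB' := hE.isDExact B hB.1
    have h := ih (shiftedCone_homExactAt φ hD (hB'.1.homExactAt ⊤)) (by
      rintro (_ | i) hi
      · omega
      · exact mapCone.isZero _ (hN (i + 2) (by omega)) (hB'.1.isZero (i + 3) (by omega)))
    have hBe : euler c B (M + 3) = 0 := by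
      rw [euler_eq_of_isZero hc (show d + 2 ≤ M + 3 by omega)
        fun i hi => hB'.1.isZero i (by omega), hrel B hB]
    rw [euler_mapCone hc] at h
    rw [euler_succ, euler_succ] at hBe
    have h1 : c ((ChainComplex.truncate.obj D).X 0) = c ((ChainComplex.truncate.obj B).X 0) :=
      hc.of_iso (@asIso _ _ _ _ (φ.f 1) i1)
    rw [euler_succ, euler_succ, hc.of_iso (asIso (φ.f 0)), h1, ← sub_eq_zero.1 h]
    exact hBe

lemma euler_eq_of_acyclic_mapCone (hd : 1 ≤ d) (hE : IsDExactStructure d E)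
    (hker : HasDKernels C d) (hgen : IsGenerating E P) (hc : IsSplitAdditive c)
    (hrel : ∀ B ∈ relative E P, euler c B (d + 2) = 0) {D B : ChainComplex C ℕ} (φ : D ⟶ B)
    (hφ : ∀ m, HomExactAt P (mapCone φ) m) {n m : ℕ} (hn : ∀ i, n ≤ i → IsZero (D.X i))
    (hm : ∀ i, m ≤ i → IsZero (B.X i)) : euler c D n = euler c B m := by
  have h := euler_eq_zero_of_acyclic hd hE hker hgen hc hrel (N := n + m + 1) hφ (by
    rintro (_ | i) hi
    · omega
    · exact mapCone.isZero _ (hn i (by omega)) (hm (i + 1) (by omega)))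
  rw [euler_mapCone hc, sub_eq_zero, euler_eq_of_isZero hc (by omega) hn,
    euler_eq_of_isZero hc (by omega) hm] at h
  exact h.symm

end Acyclic
/-! ### Presentations of modules by morphisms of `C` -/

section Presentations

open Opposite

lemma exact_of_evaluation {J : Type*} [Category* J] {S : ShortComplex (J ⥤ AddCommGrpCat.{v})}
    (h : ∀ j, (S.map ((evaluation J AddCommGrpCat.{v}).obj j)).Exact) : S.Exact := by
  rw [ShortComplex.exact_iff_isZero_homology, Functor.isZero_iff]
  intro j
  exact ((ShortComplex.exact_iff_isZero_homology _).1 (h j)).of_iso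
    (S.mapHomologyIso ((evaluation J AddCommGrpCat.{v}).obj j)).symm

variable {C : Type u} [Category.{v} C] [Preadditive C] {P : ObjectProperty C}

/-- The components of a morphism out of `C(-, X)|_P`. -/
noncomputable def evalAt {X : C} {M : P.FullSubcategoryᵒᵖ ⥤ AddCommGrpCat.{v}}
    (p : (restrictedYoneda P).obj X ⟶ M) (W : P.FullSubcategory) :
    (W.obj ⟶ X) →+ M.obj (op W) :=
  (p.app (op W)).hom

section

variable {X Y : C} {M N : P.FullSubcategoryᵒᵖ ⥤ AddCommGrpCat.{v}}
  (p : (restrictedYoneda P).obj X ⟶ M)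

lemma evalAt_precomp {W W' : P.FullSubcategory} (f : W' ⟶ W) (y : W.obj ⟶ X) :
    evalAt p W' (f.hom ≫ y) = M.map f.op (evalAt p W y) :=
  ConcreteCategory.congr_hom (p.naturality f.op) y

lemma evalAt_comp (η : M ⟶ N) (W : P.FullSubcategory) (y : W.obj ⟶ X) :
    evalAt (p ≫ η) W y = η.app (op W) (evalAt p W y) :=
  rfl

lemma evalAt_map_comp (g : Y ⟶ X) (W : P.FullSubcategory) (y : W.obj ⟶ Y) :
    evalAt ((restrictedYoneda P).map g ≫ p) W y = evalAt p W (y ≫ g) :=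
  rfl

end

/-- `C(-, X₁)|_P ⟶ C(-, X₀)|_P ⟶ M ⟶ 0` is exact, where the first morphism is induced by `f` and
the second one is `p`. -/
structure IsPresentation {X₁ X₀ : C} (f : X₁ ⟶ X₀) {M : P.FullSubcategoryᵒᵖ ⥤ AddCommGrpCat.{v}}
    (p : (restrictedYoneda P).obj X₀ ⟶ M) : Prop where
  surj : ∀ W, Function.Surjective (evalAt p W)
  exact : ∀ (W : P.FullSubcategory) (y : W.obj ⟶ X₀),
    evalAt p W y = 0 ↔ ∃ t : W.obj ⟶ X₁, t ≫ f = y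

variable {M N : P.FullSubcategoryᵒᵖ ⥤ AddCommGrpCat.{v}}

lemma IsPresentation.of_exact {X₁ X₀ : C} (f : X₁ ⟶ X₀) (p : (restrictedYoneda P).obj X₀ ⟶ M)
    (w : (restrictedYoneda P).map f ≫ p = 0)
    (h : (ShortComplex.mk ((restrictedYoneda P).map f) p w).Exact) [hp : Epi p] :
    IsPresentation f p where
  surj W := (AddCommGrpCat.epi_iff_surjective _).1 ((NatTrans.epi_iff_epi_app p).1 hp (op W))
  exact W y := by
    have := h.map ((evaluation _ AddCommGrpCat.{v}).obj (op W))
    rw [ShortComplex.ab_exact_iff_function_exact] at this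
    exact this y

lemma IsPresentation.epi {X₁ X₀ : C} {f : X₁ ⟶ X₀} {p : (restrictedYoneda P).obj X₀ ⟶ M}
    (h : IsPresentation f p) : Epi p :=
  (NatTrans.epi_iff_epi_app p).2 fun W => (AddCommGrpCat.epi_iff_surjective _).2 (h.surj W.unop)

lemma IsPresentation.w {X₁ X₀ : C} {f : X₁ ⟶ X₀} {p : (restrictedYoneda P).obj X₀ ⟶ M}
    (h : IsPresentation f p) : (restrictedYoneda P).map f ≫ p = 0 := by
  ext W y
  exact (h.exact W.unop _).2 ⟨y, rfl⟩

lemma IsPresentation.shortComplex_exact {X₁ X₀ : C} {f : X₁ ⟶ X₀}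
    {p : (restrictedYoneda P).obj X₀ ⟶ M} (h : IsPresentation f p) :
    (ShortComplex.mk ((restrictedYoneda P).map f) p h.w).Exact := by
  refine exact_of_evaluation fun W => ?_
  rw [ShortComplex.ab_exact_iff_function_exact]
  exact h.exact W.unop

variable (P) in
/-- The projection of `C(-, X₀)|_P` onto `cokerRestricted P f`. -/
noncomputable def cokerRestrictedπ {X₁ X₀ : C} (f : X₁ ⟶ X₀) :
    (restrictedYoneda P).obj X₀ ⟶ cokerRestricted P f :=
  cokernel.π ((restrictedYoneda P).map f)

lemma isPresentation_cokerRestricted {X₁ X₀ : C} (f : X₁ ⟶ X₀) :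
    IsPresentation f (cokerRestrictedπ P f) :=
  IsPresentation.of_exact f _ (cokernel.condition _) (ShortComplex.exact_cokernel _)
    (hp := inferInstanceAs (Epi (cokernel.π _)))

/-- A module presented by `f` is isomorphic to `cokerRestricted P f`. -/
noncomputable def IsPresentation.isoCokerRestricted {X₁ X₀ : C} {f : X₁ ⟶ X₀}
    {p : (restrictedYoneda P).obj X₀ ⟶ M} (h : IsPresentation f p) : M ≅ cokerRestricted P f :=
  have := h.epi
  IsColimit.coconePointUniqueUpToIso h.shortComplex_exact.gIsCokernel (colimit.isColimit _)

/-- On the objects of `P` the two Yoneda functors agree. -/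
noncomputable def yonedaIso (X : P.FullSubcategory) :
    preadditiveYoneda.obj X ≅ (restrictedYoneda P).obj X.obj :=
  NatIso.ofComponents fun W => AddEquiv.toAddCommGrpIso
    { toFun := fun f => f.hom
      invFun := fun f => ObjectProperty.homMk f
      left_inv := fun _ => rfl
      right_inv := fun _ => rfl
      map_add' := fun _ _ => rfl }

lemma yonedaIso_naturality {X Y : P.FullSubcategory} (f : X ⟶ Y) :
    preadditiveYoneda.map f ≫ (yonedaIso Y).hom =
      (yonedaIso X).hom ≫ (restrictedYoneda P).map f.hom :=
  rfl

lemma isFinitelyPresented_of_isPresentation (hM : M.Additive) {X₁ X₀ : C} (h₁ : P X₁)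
    (h₀ : P X₀) {f : X₁ ⟶ X₀} {p : (restrictedYoneda P).obj X₀ ⟶ M} (h : IsPresentation f p) :
    IsFinitelyPresented P.FullSubcategory M := by
  have := h.epi
  let F : (⟨X₁, h₁⟩ : P.FullSubcategory) ⟶ ⟨X₀, h₀⟩ := ObjectProperty.homMk f
  have hF : (restrictedYoneda P).map F.hom ≫ p = 0 := h.w
  refine ⟨hM, _, _, F, (yonedaIso _).hom ≫ p, ?_, ?_, inferInstance⟩
  · rw [← Category.assoc, yonedaIso_naturality, Category.assoc, hF, comp_zero]
  · exact ShortComplex.exact_of_iso (S₁ := ShortComplex.mk ((restrictedYoneda P).map F.hom) p hF)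
      (ShortComplex.isoMk (yonedaIso _).symm (yonedaIso _).symm (Iso.refl _)
        (by
          dsimp
          rw [Iso.inv_comp_eq, ← Category.assoc, ← yonedaIso_naturality, Category.assoc,
            Iso.hom_inv_id, Category.comp_id])
        (by simp)) h.shortComplex_exact

lemma exists_isPresentation (hM : IsFinitelyPresented P.FullSubcategory M) :
    ∃ (X₁ X₀ : P.FullSubcategory) (f : X₁ ⟶ X₀) (p : (restrictedYoneda P).obj X₀.obj ⟶ M),
      IsPresentation f.hom p := by
  obtain ⟨-, X₁, X₀, f, p, w, hex, hp⟩ := hM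
  have w' : (restrictedYoneda P).map f.hom ≫ (yonedaIso X₀).inv ≫ p = 0 := by
    rw [← cancel_epi (yonedaIso X₁).hom, ← Category.assoc, ← yonedaIso_naturality, Category.assoc,
      Iso.hom_inv_id_assoc, w, comp_zero]
  refine ⟨X₁, X₀, f, (yonedaIso X₀).inv ≫ p, IsPresentation.of_exact _ _ w' ?_⟩
  exact ShortComplex.exact_of_iso (S₁ := ShortComplex.mk _ _ w)
    (ShortComplex.isoMk (yonedaIso _) (yonedaIso _) (Iso.refl _)
      (by exact (yonedaIso_naturality f).symm) (by simp)) hex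

lemma IsPresentation.additive {X₁ X₀ : C} {f : X₁ ⟶ X₀} {p : (restrictedYoneda P).obj X₀ ⟶ M}
    (h : IsPresentation f p) : M.Additive where
  map_add {W W'} a b := by
    ext m
    obtain ⟨y, rfl⟩ := h.surj W.unop m
    have ha := evalAt_precomp p a.unop y
    have hb := evalAt_precomp p b.unop y
    have hab := evalAt_precomp p (a + b).unop y
    change M.map (a + b) _ = M.map a _ + M.map b _
    refine hab.symm.trans (Eq.trans ?_ (congrArg₂ (· + ·) ha hb))
    rw [← map_add]
    exact congrArg _ (Preadditive.add_comp _ _ _ _ _ _)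

/-- Cokernels of morphisms between restricted representables are finitely presented: approximate
`Y₀` by `x : X₀ ⟶ Y₀` and a weak kernel of `(f, x)` by an object of `P`. -/
lemma isFinitelyPresented_cokerRestricted [HasBinaryBiproducts C] {d : ℕ}
    (hker : HasDKernels C d) (hcf : IsContravariantlyFinite P) {Y₁ Y₀ : C} (f : Y₁ ⟶ Y₀) :
    IsFinitelyPresented P.FullSubcategory (cokerRestricted P f) := by
  have hp := isPresentation_cokerRestricted (P := P) f
  obtain ⟨X₀, x, hX₀, hx⟩ := hcf Y₀
  obtain ⟨B, hB, ⟨e⟩⟩ := hker (biprod.desc f x)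
  obtain ⟨X₁, k, hX₁, hk⟩ := hcf (B.X 2)
  have he : e.hom.left ≫ biprod.desc f x = B.d 1 0 ≫ e.hom.right := e.hom.w
  have he' : e.inv.left ≫ B.d 1 0 = biprod.desc f x ≫ e.inv.right := e.inv.w
  refine isFinitelyPresented_of_isPresentation hp.additive hX₁ hX₀
    (f := k ≫ B.d 2 1 ≫ e.hom.left ≫ biprod.snd) (p := (restrictedYoneda P).map x ≫ cokerRestrictedπ P f)
    ⟨fun W m => ?_, fun W y => ?_⟩
  · obtain ⟨y, rfl⟩ := hp.surj W m
    obtain ⟨y', rfl⟩ := hx W.property y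
    exact ⟨y', rfl⟩
  · rw [evalAt_map_comp, hp.exact]
    constructor
    · rintro ⟨t, ht⟩
      have h0 : biprod.lift (-t) y ≫ biprod.desc f x = 0 := by
        rw [biprod.lift_desc, Preadditive.neg_comp, ht, neg_add_cancel]
      obtain ⟨s, hs⟩ := hB.homExactAt P 0 W.property (biprod.lift (-t) y ≫ e.inv.left) (by
        change _ ≫ B.d 1 0 = 0
        rw [Category.assoc, he', reassoc_of% h0, zero_comp])
      obtain ⟨s', rfl⟩ := hk W.property s
      refine ⟨s', ?_⟩
      have hs' : s' ≫ k ≫ B.d 2 1 = biprod.lift (-t) y ≫ e.inv.left := by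
        rw [← hs, Category.assoc]
      have hid : e.inv.left ≫ e.hom.left = 𝟙 _ := congrArg Arrow.Hom.left e.inv_hom_id
      rw [reassoc_of% hs', reassoc_of% hid]
      exact biprod.lift_snd _ _
    · rintro ⟨t, rfl⟩
      refine ⟨-(t ≫ k ≫ B.d 2 1 ≫ e.hom.left ≫ biprod.fst), ?_⟩
      have h0 : B.d 2 1 ≫ e.hom.left ≫ (biprod.fst ≫ f + biprod.snd ≫ x) = 0 := by
        rw [← biprod.desc_eq, he, HomologicalComplex.d_comp_d_assoc, zero_comp]
      simp only [Preadditive.comp_add] at h0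
      simp only [Preadditive.neg_comp, Category.assoc]
      rw [neg_eq_iff_add_eq_zero, ← Preadditive.comp_add, ← Preadditive.comp_add, h0, comp_zero,
        comp_zero]

end Presentations
/-! ### Resolutions of modules by complexes in `C` -/

section Resolutions

open Opposite

variable {C : Type u} [Category.{v} C] [Preadditive C] {P : ObjectProperty C}
  {L M N : P.FullSubcategoryᵒᵖ ⥤ AddCommGrpCat.{v}}

/-- The complex `C(-, A)|_P` is a resolution of `M`, with augmentation `p`. -/
structure IsResolution (A : ChainComplex C ℕ) (p : (restrictedYoneda P).obj (A.X 0) ⟶ M) :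
    Prop where
  presentation : IsPresentation (A.d 1 0) p
  exact : ∀ n, HomExactAt P A (n + 1)

lemma IsPresentation.of_arrow_iso {X₁ X₀ Y₁ Y₀ : C} {f : X₁ ⟶ X₀} {g : Y₁ ⟶ Y₀}
    {p : (restrictedYoneda P).obj X₀ ⟶ M} (h : IsPresentation f p)
    (e : Arrow.mk g ≅ Arrow.mk f) :
    IsPresentation g ((restrictedYoneda P).map e.hom.right ≫ p) where
  surj W m := by
    obtain ⟨y, rfl⟩ := h.surj W m
    have hid : e.inv.right ≫ e.hom.right = 𝟙 X₀ := Arrow.inv_hom_id_right e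
    refine ⟨y ≫ e.inv.right, ?_⟩
    rw [evalAt_map_comp, Category.assoc, hid, Category.comp_id]
  exact W y := by
    have he : e.hom.left ≫ f = g ≫ e.hom.right := e.hom.w
    have he' : e.inv.left ≫ g = f ≫ e.inv.right := e.inv.w
    have hid : e.hom.right ≫ e.inv.right = 𝟙 Y₀ := Arrow.hom_inv_id_right e
    rw [evalAt_map_comp, h.exact]
    constructor
    · rintro ⟨t, ht⟩
      refine ⟨t ≫ e.inv.left, ?_⟩
      rw [Category.assoc, he', reassoc_of% ht, hid, Category.comp_id]
    · rintro ⟨t, rfl⟩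
      exact ⟨t ≫ e.hom.left, by rw [Category.assoc, he, Category.assoc]⟩

/-- A finitely presented module has a resolution by a left `d`-exact sequence whose last two terms
lie in `P`. -/
lemma exists_isResolution {d : ℕ} (hker : HasDKernels C d)
    (hP : ∀ ⦃X Y : C⦄, (X ≅ Y) → P X → P Y) (hM : IsFinitelyPresented P.FullSubcategory M) :
    ∃ A : ChainComplex C ℕ, IsLeftDExact d A ∧ P (A.X 0) ∧ P (A.X 1) ∧
      ∃ p : (restrictedYoneda P).obj (A.X 0) ⟶ M, IsResolution A p := by
  obtain ⟨X₁, X₀, f, p, hp⟩ := exists_isPresentation hM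
  obtain ⟨A, hA, ⟨e⟩⟩ := hker f.hom
  exact ⟨A, hA, hP (Arrow.rightFunc.mapIso e).symm X₀.property,
    hP (Arrow.leftFunc.mapIso e).symm X₁.property, _, hp.of_arrow_iso e, hA.homExactAt P⟩

/-- A morphism of modules lifts to a chain map. In degrees `0` and `1` the terms of `D` are
projective relative to `C(-, A)|_P`; in higher degrees `A` is exact on all of `C`. -/
lemma exists_lift_of_presentation {D A : ChainComplex C ℕ} (h₀ : P (D.X 0)) (h₁ : P (D.X 1))
    {q : (restrictedYoneda P).obj (D.X 0) ⟶ M} (hq : IsPresentation (D.d 1 0) q)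
    (hA : ∀ n, HomExactAt ⊤ A (n + 1)) {p : (restrictedYoneda P).obj (A.X 0) ⟶ N}
    (hp : IsPresentation (A.d 1 0) p) (η : M ⟶ N) :
    ∃ φ : D ⟶ A, ∀ (W : P.FullSubcategory) (y : W.obj ⟶ D.X 0),
      evalAt p W (y ≫ φ.f 0) = η.app (op W) (evalAt q W y) := by
  obtain ⟨φ₀, hφ₀⟩ := hp.surj ⟨D.X 0, h₀⟩ (η.app _ (evalAt q ⟨D.X 0, h₀⟩ (𝟙 _)))
  change D.X 0 ⟶ A.X 0 at φ₀
  have key : ∀ (W : P.FullSubcategory) (y : W.obj ⟶ D.X 0),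
      evalAt p W (y ≫ φ₀) = η.app (op W) (evalAt q W y) := by
    intro W y
    let y' : W ⟶ ⟨D.X 0, h₀⟩ := ObjectProperty.homMk y
    have h1 := evalAt_precomp p y' φ₀
    rw [hφ₀] at h1
    refine h1.trans ((evalAt_precomp (q ≫ η) y' (𝟙 _)).symm.trans ?_)
    rw [evalAt_comp, Category.comp_id]
    rfl
  obtain ⟨φ₁, hφ₁⟩ := (hp.exact ⟨D.X 1, h₁⟩ (D.d 1 0 ≫ φ₀)).1 (by
    rw [key, (hq.exact ⟨D.X 1, h₁⟩ (D.d 1 0)).2 ⟨𝟙 _, Category.id_comp _⟩, map_zero])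
  obtain ⟨φ, h0, -⟩ := exists_lift hA φ₀ φ₁ hφ₁
  exact ⟨φ, by rwa [h0]⟩

variable [HasBinaryBiproducts C]

/-- The mapping cone of a chain map over an isomorphism is acyclic on `P`. -/
lemma mapCone_homExactAt_of_isIso {D A : ChainComplex C ℕ}
    {q : (restrictedYoneda P).obj (D.X 0) ⟶ M} (hq : IsResolution D q)
    {p : (restrictedYoneda P).obj (A.X 0) ⟶ N} (hp : IsResolution A p) (η : M ⟶ N) [IsIso η]
    (φ : D ⟶ A) (hφ : ∀ (W : P.FullSubcategory) (y : W.obj ⟶ D.X 0),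
      evalAt p W (y ≫ φ.f 0) = η.app (op W) (evalAt q W y)) (n : ℕ) :
    HomExactAt P (mapCone φ) n := by
  have hη : ∀ W : P.FullSubcategory, Function.Bijective (η.app (op W)) := fun W =>
    ConcreteCategory.bijective_of_isIso (η.app (op W))
  rcases n with _ | n
  · refine mapCone.homExactAt_zero _ fun W hW z => ?_
    obtain ⟨m, hm⟩ := (hη ⟨W, hW⟩).2 (evalAt p ⟨W, hW⟩ z)
    obtain ⟨y, rfl⟩ := hq.presentation.surj _ m
    obtain ⟨t, ht⟩ := (hp.presentation.exact ⟨W, hW⟩ (z - y ≫ φ.f 0)).1 (by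
      rw [map_sub, hφ, hm, sub_self])
    exact ⟨y, t, by rw [ht, add_sub_cancel]⟩
  · refine mapCone.homExactAt_succ _ (fun W hW y t hy hyt => ?_) (hp.exact n)
    rcases n with _ | n
    · refine (hq.presentation.exact ⟨W, hW⟩ y).1 ((hη ⟨W, hW⟩).1 ?_)
      rw [map_zero, ← hφ, (hp.presentation.exact ⟨W, hW⟩ _).2
        ⟨-t, by rw [Preadditive.neg_comp, neg_eq_iff_add_eq_zero, add_comm]; exact hyt⟩]
    · exact hq.exact n hW y hy

/-- The mapping cone of a chain map over a monomorphism resolves its cokernel. -/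
lemma isResolution_mapCone {D A : ChainComplex C ℕ}
    {q : (restrictedYoneda P).obj (D.X 0) ⟶ L} (hq : IsResolution D q)
    {p : (restrictedYoneda P).obj (A.X 0) ⟶ M} (hp : IsResolution A p) (η : L ⟶ M) (ρ : M ⟶ N)
    (hη : ∀ W, Function.Injective (η.app (op W))) (hρ : ∀ W, Function.Surjective (ρ.app (op W)))
    (hex : ∀ W, Function.Exact (η.app (op W)) (ρ.app (op W)))
    (φ : D ⟶ A) (hφ : ∀ (W : P.FullSubcategory) (y : W.obj ⟶ D.X 0),
      evalAt p W (y ≫ φ.f 0) = η.app (op W) (evalAt q W y)) :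
    IsResolution (mapCone φ) ((restrictedYoneda P).map (mapCone.snd φ 0) ≫ p ≫ ρ) where
  presentation :=
    { surj := fun W m => by
        obtain ⟨m, rfl⟩ := hρ W m
        obtain ⟨y, rfl⟩ := hp.presentation.surj W m
        refine ⟨y ≫ mapCone.inr φ 0, ?_⟩
        rw [evalAt_map_comp, Category.assoc, mapCone.inr_snd, Category.comp_id, evalAt_comp]
      exact := fun W y => by
        obtain ⟨y, rfl⟩ := mapCone.exists_eq_to_zero φ y
        rw [evalAt_map_comp, Category.assoc, mapCone.inr_snd, Category.comp_id, evalAt_comp,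
          hex W]
        constructor
        · rintro ⟨l, hl⟩
          obtain ⟨x, rfl⟩ := hq.presentation.surj W l
          obtain ⟨t, ht⟩ := (hp.presentation.exact W (y - x ≫ φ.f 0)).1 (by
            rw [map_sub, hφ, hl, sub_self])
          refine ⟨x ≫ mapCone.inl φ 0 + t ≫ mapCone.inr φ 1, ?_⟩
          rw [Preadditive.add_comp, Category.assoc, Category.assoc, mapCone.inl_d_one,
            mapCone.inr_d, reassoc_of% ht, Preadditive.sub_comp, Category.assoc, add_sub_cancel]
        · rintro ⟨z, hz⟩
          obtain ⟨x, t, rfl⟩ := mapCone.exists_eq_to φ z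
          have hy : x ≫ φ.f 0 + t ≫ A.d 1 0 = y := by
            rw [Preadditive.add_comp, Category.assoc, Category.assoc, mapCone.inl_d_one,
              mapCone.inr_d] at hz
            have := congrArg (· ≫ mapCone.snd φ 0) hz
            simpa [mapCone.inr_snd] using this
          refine ⟨evalAt q W x, ?_⟩
          rw [← hφ, ← hy, map_add, (hp.presentation.exact W (t ≫ A.d 1 0)).2 ⟨t, rfl⟩, add_zero] }
  exact n := mapCone.homExactAt_succ _ (fun W hW y t hy hyt => by
    rcases n with _ | n
    · refine (hq.presentation.exact ⟨W, hW⟩ y).1 (hη ⟨W, hW⟩ ?_)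
      rw [map_zero, ← hφ, (hp.presentation.exact ⟨W, hW⟩ _).2
        ⟨-t, by rw [Preadditive.neg_comp, neg_eq_iff_add_eq_zero, add_comm]; exact hyt⟩]
    · exact hq.exact n hW y hy) (hp.exact n)

end Resolutions

/-! ### Homomorphisms out of Grothendieck groups -/

section Grothendieck

section

variable {C : Type u} [Category.{v} C] [Preadditive C] {G : Type*} [AddCommGroup G]

/-- The homomorphism out of the split Grothendieck group given by a split additive function. -/
noncomputable def splitK0Lift (c : C → G) (hiso : ∀ X Y : C, (X ≅ Y) → c X = c Y)
    (hc : IsSplitAdditive c) : SplitK0 C →+ G :=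
  QuotientAddGroup.lift _
    (FreeAbelianGroup.lift (Quotient.lift c fun X Y ⟨e⟩ => hiso X Y e)) (by
      rw [AddSubgroup.closure_le]
      rintro _ ⟨S, hS, rfl⟩
      change FreeAbelianGroup.lift _ (_ - _ + _) = 0
      rw [map_add, map_sub, isoClass, isoClass, isoClass, FreeAbelianGroup.lift_apply_of,
        FreeAbelianGroup.lift_apply_of, FreeAbelianGroup.lift_apply_of]
      exact hc S hS)

lemma splitK0Lift_splitClass (c : C → G) (hiso : ∀ X Y : C, (X ≅ Y) → c X = c Y)
    (hc : IsSplitAdditive c) (X : C) : splitK0Lift c hiso hc (splitClass X) = c X :=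
  FreeAbelianGroup.lift_apply_of _ _

lemma splitClass_congr {X Y : C} (e : X ≅ Y) : splitClass X = splitClass Y := by
  have : (Quotient.mk (isIsomorphicSetoid C) X) = Quotient.mk (isIsomorphicSetoid C) Y :=
    Quotient.sound ⟨e⟩
  rw [splitClass, isoClass, this]
  rfl

lemma isSplitAdditive_splitClass : IsSplitAdditive (splitClass : C → SplitK0 C) := fun S hS =>
  (QuotientAddGroup.eq_zero_iff _).2 (AddSubgroup.subset_closure ⟨S, hS, rfl⟩)

/-- The projection of the split Grothendieck group onto `K₀(C, E)`. -/
def K0.proj (d : ℕ) (E : Set (ChainComplex C ℕ)) : SplitK0 C →+ K0 C d E :=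
  QuotientAddGroup.mk' _

lemma isSplitAdditive_cls (d : ℕ) (E : Set (ChainComplex C ℕ)) : IsSplitAdditive (K0.cls d E) := by
  intro S hS
  have := congrArg (K0.proj d E) (isSplitAdditive_splitClass S hS)
  rwa [map_add, map_sub, map_zero] at this

lemma euler_cls_eq_zero {d : ℕ} {E : Set (ChainComplex C ℕ)} {B : ChainComplex C ℕ} (hB : B ∈ E) :
    euler (K0.cls d E) B (d + 2) = 0 := by
  have h : K0.proj d E (∑ i ∈ Finset.range (d + 2), (-1 : ℤ) ^ i • splitClass (B.X i)) = 0 :=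
    (QuotientAddGroup.eq_zero_iff _).2 (AddSubgroup.subset_closure ⟨B, hB, rfl⟩)
  rw [map_sum] at h
  rw [← h]
  exact Finset.sum_congr rfl fun i _ => (map_zsmul (K0.proj d E) _ _).symm

end

variable {D : Type u} [Category.{v} D] [Preadditive D] {G : Type*} [AddCommGroup G]

lemma splitting_shortExact {S : ShortComplex (FPMod D)} (s : S.Splitting) :
    (S.map (IsFinitelyPresented D).ι).ShortExact :=
  (s.map (IsFinitelyPresented D).ι).shortExact

lemma isSplitAdditive_of_shortExact {c : FPMod D → G}
    (hc : ∀ S : ShortComplex (FPMod D), (S.map (IsFinitelyPresented D).ι).ShortExact →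
      c S.X₁ - c S.X₂ + c S.X₃ = 0) : IsSplitAdditive c :=
  fun S ⟨s⟩ => hc S (splitting_shortExact s)

/-- The homomorphism out of `K₀(mod D)` given by a function that is invariant under isomorphisms and
additive on short exact sequences. -/
noncomputable def k0ModLift (c : FPMod D → G) (hiso : ∀ M N : FPMod D, (M ≅ N) → c M = c N)
    (hc : ∀ S : ShortComplex (FPMod D), (S.map (IsFinitelyPresented D).ι).ShortExact →
      c S.X₁ - c S.X₂ + c S.X₃ = 0) : K0Mod D →+ G :=
  QuotientAddGroup.lift _
    (splitK0Lift c hiso (isSplitAdditive_of_shortExact hc)) (by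
      rw [AddSubgroup.closure_le]
      rintro _ ⟨S, hS, rfl⟩
      change splitK0Lift c hiso _ (_ - _ + _) = 0
      rw [map_add, map_sub, splitK0Lift_splitClass, splitK0Lift_splitClass, splitK0Lift_splitClass,
        hc S hS])

lemma k0ModLift_modClass (c : FPMod D → G) (hiso : ∀ M N : FPMod D, (M ≅ N) → c M = c N)
    (hc : ∀ S : ShortComplex (FPMod D), (S.map (IsFinitelyPresented D).ι).ShortExact →
      c S.X₁ - c S.X₂ + c S.X₃ = 0) (M : Dᵒᵖ ⥤ AddCommGrpCat.{v})
    (hM : IsFinitelyPresented D M) : k0ModLift c hiso hc (modClass M hM) = c ⟨M, hM⟩ :=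
  splitK0Lift_splitClass c hiso (isSplitAdditive_of_shortExact hc) _

lemma modClass_congr {M N : Dᵒᵖ ⥤ AddCommGrpCat.{v}} (hM : IsFinitelyPresented D M)
    (hN : IsFinitelyPresented D N) (e : M ≅ N) : modClass M hM = modClass N hN := by
  have : splitClass (⟨M, hM⟩ : FPMod D) = splitClass (⟨N, hN⟩ : FPMod D) :=
    splitClass_congr (ObjectProperty.isoMk _ e)
  rw [modClass, this]
  rfl

lemma k0Mod_hom_ext {F F' : K0Mod D →+ G}
    (h : ∀ M (hM : IsFinitelyPresented D M), F (modClass M hM) = F' (modClass M hM)) : F = F' := by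
  apply QuotientAddGroup.addMonoidHom_ext
  apply QuotientAddGroup.addMonoidHom_ext
  apply FreeAbelianGroup.lift_ext
  rintro ⟨M, hM⟩
  exact h M hM

end Grothendieck
/-! ### The index homomorphism -/

section Index

open Opposite

variable {C : Type u} [Category.{v} C] [Preadditive C] [HasBinaryBiproducts C] [HasZeroObject C]
  [IsIdempotentComplete C] {d : ℕ} {E : Set (ChainComplex C ℕ)} {P : ObjectProperty C}

/-- Resolutions of isomorphic modules by left `d`-exact sequences have the same Euler characteristic
in `K₀(C, E_P)`, provided that one of them ends in objects of `P`. -/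
lemma euler_eq_of_isResolution (hd : 1 ≤ d) (hE : IsDExactStructure d E) (hker : HasDKernels C d)
    (hgen : IsGenerating E P) {M N : P.FullSubcategoryᵒᵖ ⥤ AddCommGrpCat.{v}} (e : M ≅ N)
    {D A : ChainComplex C ℕ} {n : ℕ} (hDn : ∀ i, n ≤ i → IsZero (D.X i)) (h₀ : P (D.X 0))
    (h₁ : P (D.X 1)) {q : (restrictedYoneda P).obj (D.X 0) ⟶ M} (hq : IsResolution D q)
    (hA : IsLeftDExact d A) {p : (restrictedYoneda P).obj (A.X 0) ⟶ N}
    (hp : IsPresentation (A.d 1 0) p) :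
    euler (K0.cls d (relative E P)) D n = euler (K0.cls d (relative E P)) A (d + 2) := by
  obtain ⟨φ, hφ⟩ := exists_lift_of_presentation h₀ h₁ hq.presentation (hA.homExactAt ⊤) hp e.hom
  exact euler_eq_of_acyclic_mapCone hd hE hker hgen (isSplitAdditive_cls d _)
    (fun B hB => euler_cls_eq_zero hB) φ
    (mapCone_homExactAt_of_isIso hq ⟨hp, hA.homExactAt P⟩ e.hom φ hφ) hDn
    (fun i hi => hA.isZero i hi)

/-- Euler characteristics of resolutions are additive on short exact sequences: the mapping cone of
a lift of `L ⟶ M` is a resolution of the cokernel `N`. -/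
lemma euler_additive (hd : 1 ≤ d) (hE : IsDExactStructure d E) (hker : HasDKernels C d)
    (hadd : IsAdditiveSubcategory P) (hgen : IsGenerating E P)
    {S : ShortComplex (P.FullSubcategoryᵒᵖ ⥤ AddCommGrpCat.{v})} (hS : S.ShortExact)
    {A₁ A₂ A₃ : ChainComplex C ℕ} (h₁ : IsLeftDExact d A₁) (h₁₀ : P (A₁.X 0)) (h₁₁ : P (A₁.X 1))
    {p₁ : (restrictedYoneda P).obj (A₁.X 0) ⟶ S.X₁} (hp₁ : IsResolution A₁ p₁)
    (h₂ : IsLeftDExact d A₂) (h₂₀ : P (A₂.X 0)) (h₂₁ : P (A₂.X 1))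
    {p₂ : (restrictedYoneda P).obj (A₂.X 0) ⟶ S.X₂} (hp₂ : IsResolution A₂ p₂)
    (h₃ : IsLeftDExact d A₃) {p₃ : (restrictedYoneda P).obj (A₃.X 0) ⟶ S.X₃}
    (hp₃ : IsPresentation (A₃.d 1 0) p₃) :
    euler (K0.cls d (relative E P)) A₁ (d + 2) - euler (K0.cls d (relative E P)) A₂ (d + 2) +
      euler (K0.cls d (relative E P)) A₃ (d + 2) = 0 := by
  have hev : ∀ W, (S.map ((evaluation _ AddCommGrpCat.{v}).obj W)).ShortExact :=
    fun W => hS.map_of_exact _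
  obtain ⟨φ, hφ⟩ := exists_lift_of_presentation h₁₀ h₁₁ hp₁.presentation (h₂.homExactAt ⊤)
    hp₂.presentation S.f
  have hcone := isResolution_mapCone hp₁ hp₂ S.f S.g (fun W => (hev (op W)).ab_injective_f)
    (fun W => (hev (op W)).ab_surjective_g)
    (fun W => (ShortComplex.ab_exact_iff_function_exact _).1 (hev (op W)).exact) φ hφ
  have hP₁ : P ((mapCone φ).X 1) :=
    hadd.biprod (BinaryBiproduct.bicone (A₁.X 0) (A₂.X 1)) ⟨BinaryBiproduct.isBilimit _ _⟩ h₁₀ h₂₁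
  have h := euler_eq_of_isResolution (D := mapCone φ) (n := d + 3) hd hE hker hgen (Iso.refl S.X₃) (by
    rintro (_ | i) hi
    · omega
    · exact mapCone.isZero _ (h₁.isZero i (by omega)) (h₂.isZero (i + 1) (by omega)))
    h₂₀ hP₁ hcone h₃ hp₃
  have hc := isSplitAdditive_cls d (relative E P)
  rw [euler_mapCone hc, euler_eq_of_isZero hc (show d + 2 ≤ d + 2 + 1 by omega)
    fun i hi => h₂.isZero i hi] at h
  rw [← h]
  abel

end Index
end DExact

theorem proposition1p3 {C : Type u} [Category.{v} C]
    [Preadditive C] [HasFiniteBiproducts C]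
    [IsIdempotentComplete C]
    (d : ℕ) (hd : 1 ≤ d) (E : Set (ChainComplex C ℕ)) (hE : IsDExactStructure d E)
    (hker : HasDKernels C d)
    (P : ObjectProperty C) (hadd : IsAdditiveSubcategory P)
    (hcf : IsContravariantlyFinite P) (hgen : IsGenerating E P) :
    ∃ hfp : ∀ {X Y : C} (f : X ⟶ Y), IsFinitelyPresented P.FullSubcategory (cokerRestricted P f),
    ∃ θ : K0Mod P.FullSubcategory →+ K0 C d (relative E P),
      (∀ A ∈ E, θ (modClass (cokerRestricted P (A.d 1 0)) (hfp _)) =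
        ∑ i ∈ Finset.range (d + 2), (-1 : ℤ) ^ i • K0.cls d (relative E P) (A.X i)) ∧
      (∀ A : ChainComplex C ℕ, IsLeftDExact d A →
        θ (modClass (cokerRestricted P (A.d 1 0)) (hfp _)) =
          ∑ i ∈ Finset.range (d + 2), (-1 : ℤ) ^ i • K0.cls d (relative E P) (A.X i)) ∧
      ∀ F : K0Mod P.FullSubcategory →+ K0 C d (relative E P),
        (∀ A : ChainComplex C ℕ, IsLeftDExact d A →
          F (modClass (cokerRestricted P (A.d 1 0)) (hfp _)) =
            ∑ i ∈ Finset.range (d + 2), (-1 : ℤ) ^ i • K0.cls d (relative E P) (A.X i)) →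
        F = θ := by
  have hbi : HasBinaryBiproducts C := hasBinaryBiproducts_of_finite_biproducts C
  have hfp : ∀ {X Y : C} (f : X ⟶ Y),
      IsFinitelyPresented P.FullSubcategory (cokerRestricted P f) :=
    fun f => isFinitelyPresented_cokerRestricted hker hcf f
  choose A hA hA₀ hA₁ p hp using
    fun M : FPMod P.FullSubcategory => exists_isResolution hker hadd.of_iso M.property
  have hiso : ∀ (M : FPMod P.FullSubcategory) (B : ChainComplex C ℕ), IsLeftDExact d B →
      (M.obj ≅ cokerRestricted P (B.d 1 0)) → euler (K0.cls d (relative E P)) (A M) (d + 2) =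
        euler (K0.cls d (relative E P)) B (d + 2) := fun M B hB e =>
    euler_eq_of_isResolution hd hE hker hgen e (fun i hi => (hA M).isZero i hi) (hA₀ M) (hA₁ M)
      (hp M) hB (isPresentation_cokerRestricted _)
  let θ : K0Mod P.FullSubcategory →+ K0 C d (relative E P) :=
    k0ModLift (fun M => euler (K0.cls d (relative E P)) (A M) (d + 2))
      (fun M N e => euler_eq_of_isResolution hd hE hker hgen
        ((IsFinitelyPresented P.FullSubcategory).ι.mapIso e) (fun i hi => (hA M).isZero i hi)
        (hA₀ M) (hA₁ M) (hp M) (hA N) (hp N).presentation)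
      (fun S hS => euler_additive hd hE hker hadd hgen hS (hA S.X₁) (hA₀ S.X₁) (hA₁ S.X₁)
        (hp S.X₁) (hA S.X₂) (hA₀ S.X₂) (hA₁ S.X₂) (hp S.X₂) (hA S.X₃) (hp S.X₃).presentation)
  have hθ : ∀ B : ChainComplex C ℕ, IsLeftDExact d B →
      θ (modClass (cokerRestricted P (B.d 1 0)) (hfp _)) =
        ∑ i ∈ Finset.range (d + 2), (-1 : ℤ) ^ i • K0.cls d (relative E P) (B.X i) :=
    fun B hB => (k0ModLift_modClass _ _ _ _ _).trans (hiso _ B hB (Iso.refl _))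
  refine ⟨hfp, θ, fun B hB => hθ B (hE.isDExact B hB).1, hθ, fun F hF => ?_⟩
  refine k0Mod_hom_ext fun M hM => ?_
  -- `M` is the cokernel of the last morphism of its resolution.
  have e : M ≅ cokerRestricted P ((A ⟨M, hM⟩).d 1 0) :=
    (hp ⟨M, hM⟩).presentation.isoCokerRestricted
  rw [modClass_congr hM (hfp _) e, hF _ (hA _), hθ _ (hA _)]
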